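/- Let $\Omega\subseteq\mathbb{R}^d$, $d\ge 1$, be a non-empty open set, bounded or unbounded, and let functions on $\Omega$ take values in $\mathbb{K}=\mathbb{R}$ or $\mathbb{K}=\mathbb{C}$. Let $a\in L_1(\mathbb{R}^d)$ be non-negative and suppose that for some $r>0$ and $c_0>0$ one has $a(z)\ge c_0$ for almost all $z$ in the ball $B_0=\{|z|<r\}$. Suppose that the connected components of $\Omega$ can be listed in a finite or infinite sequence $\Omega_1,\Omega_2,\dots$ such that $\operatorname{dist}(\Omega_i,\Omega_{i+1})<r$ for consecutive components (no condition if $\Omega$ is connected). Let $\varphi:[0,\infty)\times\Omega\times\Omega\to[0,\infty)$ satisfy: (C1) for each $u\in L_{1,loc}(\Omega)$ the function $(x,y)\mapsto\varphi(|u(x)-u(y)|,x,y)$ is measurable on $\Omega\times\Omega$; (C2) for every $\varepsilon>0$ there is $\delta\in(0,1)$ such that $\varphi\left(\frac{s+t}{2},x,y\right)\le(1-\delta)\frac{\varphi(s,x,y)+\varphi(t,x,y)}{2}$ for almost all $(x,y)\in\Omega\times\Omega$ and all $s,t>0$ with $|s-t|\ge\varepsilon\max\{s,t\}$; (C3) there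 are constants $1<p_-\le p_+$ and $\beta\ge1$ such that for almost all $(x,y)\in\Omega\times\Omega$ and all $0<s\le t$ one has $\frac{\varphi(s,x,y)}{s^{p_-}}\le\beta\frac{\varphi(t,x,y)}{t^{p_-}}$ and $\frac{\varphi(t,x,y)}{t^{p_+}}\le\beta\frac{\varphi(s,x,y)}{s^{p_+}}$; (C4) there is a constant $c_1>0$ such that for almost all $(x,y)\in\Omega\times\Omega$ one has $c_1^{-1}\le\varphi(1,x,y)\le c_1$, $\varphi(0,x,y)=0$, and $\varphi(t,x,y)>0$ for all $t>0$. For $u\in L_{1,loc}(\Omega)$ put $$F(u)=\int_{\Omega\times\Omega}\varphi(|u(x)-u(y)|,x,y)\,a(x-y)\,dx\,dy\in[0,\infty],\qquad |u|_{p,\Omega}=\inf\{\lambda>0:\ F(u/\lambda)\le1\}\in[0,\infty],$$ with $\inf\emptyset=\infty$. Let $\Lambda(\Omega)$ be the set of cosets $\mathbf{U}$ of functions in $L_{1,loc}(\Omega)$, modulo the relation "$u-v$ is almost everywhere on $\Omega$ equal to a constant", for which $|\mathbf{U}|_{p,\Omega}:=|u|_{p,\Omega}$, $u\in\mathbf{U}$,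 is finite; this value does not depend on the choice of $u\in\mathbf U$. Then $\Lambda(\Omega)$ is a linear space, $|\cdot|_{p,\Omega}$ is a norm on $\Lambda(\Omega)$, the space $\Lambda(\Omega)$ with this norm is a Banach space, and the norm is uniformly convex: for every $\varepsilon>0$ there is $\delta>0$ such that $|\mathbf{U}+\mathbf{V}|_{p,\Omega}\le2-\delta$ whenever $|\mathbf{U}|_{p,\Omega}=|\mathbf{V}|_{p,\Omega}=1$ and $|\mathbf{U}-\mathbf{V}|_{p,\Omega}\ge\varepsilon$. -/

import Mathlib

open MeasureTheory Set
open scoped ENNReal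

noncomputable section

namespace NonlocalOrlicz

/-- Every connected component of `Ω` occurs in a sequence `C 0, C 1, …` of components of `Ω` whose
consecutive members have distance (infimum of the distances of points) less than `r`.
Repetitions are allowed, so that a finite enumeration is continued with its last member;
for connected nonempty `Ω` and `r > 0` the constant sequence will do. -/
def ComponentsLinked {d : ℕ} (Ω : Set (EuclideanSpace ℝ (Fin d))) (r : ℝ) : Prop :=
  ∃ C : ℕ → Set (EuclideanSpace ℝ (Fin d)),
    range C = (fun x => connectedComponentIn Ω x) '' Ω ∧
    ∀ i, (⨅ x ∈ C i, ⨅ y ∈ C (i + 1), edist x y) < ENNReal.ofReal r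

/-- `r` is almost increasing on `(0, ∞)` with constant `β`. -/
def AlmostIncreasing (β : ℝ) (r : ℝ → ℝ) : Prop :=
  ∀ s t : ℝ, 0 < s → s ≤ t → r s ≤ β * r t

/-- `r` is almost decreasing on `(0, ∞)` with constant `β`. -/
def AlmostDecreasing (β : ℝ) (r : ℝ → ℝ) : Prop :=
  ∀ s t : ℝ, 0 < s → s ≤ t → r t ≤ β * r s

section Integrand

variable {d : ℕ}

/-- Measurability condition: `φ(|u(x) - u(y)|, x, y)` is (Lebesgue) measurable on `Ω × Ω` for every
locally integrable `𝕜`-valued function `u` on `Ω`. -/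
def MeasurabilityCondition (𝕜 : Type*) [RCLike 𝕜] (Ω : Set (EuclideanSpace ℝ (Fin d)))
    (φ : ℝ → EuclideanSpace ℝ (Fin d) → EuclideanSpace ℝ (Fin d) → ℝ) : Prop :=
  ∀ u : EuclideanSpace ℝ (Fin d) → 𝕜, LocallyIntegrableOn u Ω volume →
    AEMeasurable
      (fun z : EuclideanSpace ℝ (Fin d) × EuclideanSpace ℝ (Fin d) => φ ‖u z.1 - u z.2‖ z.1 z.2)
      (volume.restrict (Ω ×ˢ Ω))

/-- Uniform convexity in the first variable, for almost all `(x, y) ∈ Ω × Ω`. -/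
def UniformConvexityCondition (Ω : Set (EuclideanSpace ℝ (Fin d)))
    (φ : ℝ → EuclideanSpace ℝ (Fin d) → EuclideanSpace ℝ (Fin d) → ℝ) : Prop :=
  ∀ ε : ℝ, 0 < ε → ∃ δ ∈ Ioo (0 : ℝ) 1,
    ∀ᵐ z ∂((volume : Measure (EuclideanSpace ℝ (Fin d) × EuclideanSpace ℝ (Fin d))).restrict
        (Ω ×ˢ Ω)),
      ∀ s t : ℝ, 0 < s → 0 < t → ε * max s t ≤ |s - t| →
        φ ((s + t) / 2) z.1 z.2 ≤ (1 - δ) * ((φ s z.1 z.2 + φ t z.1 z.2) / 2)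

/-- Power growth condition with exponents `pm ≤ pp` and constant `β`. -/
def GrowthCondition (Ω : Set (EuclideanSpace ℝ (Fin d)))
    (φ : ℝ → EuclideanSpace ℝ (Fin d) → EuclideanSpace ℝ (Fin d) → ℝ) (pm pp β : ℝ) : Prop :=
  ∀ᵐ z ∂((volume : Measure (EuclideanSpace ℝ (Fin d) × EuclideanSpace ℝ (Fin d))).restrict
      (Ω ×ˢ Ω)),
    AlmostIncreasing β (fun t => φ t z.1 z.2 / t ^ pm) ∧
    AlmostDecreasing β (fun t => φ t z.1 z.2 / t ^ pp)

/-- Normalization of `φ`: two-sided bound at `t = 1`, vanishing at `t = 0`, positivity for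
`t > 0`. -/
def NormalizationCondition (Ω : Set (EuclideanSpace ℝ (Fin d)))
    (φ : ℝ → EuclideanSpace ℝ (Fin d) → EuclideanSpace ℝ (Fin d) → ℝ) (c₁ : ℝ) : Prop :=
  ∀ᵐ z ∂((volume : Measure (EuclideanSpace ℝ (Fin d) × EuclideanSpace ℝ (Fin d))).restrict
      (Ω ×ˢ Ω)),
    c₁⁻¹ ≤ φ 1 z.1 z.2 ∧ φ 1 z.1 z.2 ≤ c₁ ∧
    φ 0 z.1 z.2 = 0 ∧ ∀ t : ℝ, 0 < t → 0 < φ t z.1 z.2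

/-- The functional `F(u) = ∫_{Ω × Ω} φ(|u(x) - u(y)|, x, y) a(x - y) dx dy ∈ [0, ∞]`. -/
def energy {𝕜 : Type*} [RCLike 𝕜] (Ω : Set (EuclideanSpace ℝ (Fin d)))
    (a : EuclideanSpace ℝ (Fin d) → ℝ)
    (φ : ℝ → EuclideanSpace ℝ (Fin d) → EuclideanSpace ℝ (Fin d) → ℝ)
    (u : EuclideanSpace ℝ (Fin d) → 𝕜) : ℝ≥0∞ :=
  ∫⁻ z in Ω ×ˢ Ω, ENNReal.ofReal (φ ‖u z.1 - u z.2‖ z.1 z.2 * a (z.1 - z.2)) ∂volume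

/-- The Luxemburg functional `|u| = inf {l > 0 : F(u / l) ≤ 1} ∈ [0, ∞]`, with `inf ∅ = ∞`. -/
def luxemburg {𝕜 : Type*} [RCLike 𝕜] (Ω : Set (EuclideanSpace ℝ (Fin d)))
    (a : EuclideanSpace ℝ (Fin d) → ℝ)
    (φ : ℝ → EuclideanSpace ℝ (Fin d) → EuclideanSpace ℝ (Fin d) → ℝ)
    (u : EuclideanSpace ℝ (Fin d) → 𝕜) : ℝ≥0∞ :=
  ⨅ (l : ℝ) (_ : 0 < l) (_ : energy Ω a φ (fun x => u x / (l : 𝕜)) ≤ 1), ENNReal.ofReal l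

end Integrand

section Quotient

variable (𝕜 : Type*) [RCLike 𝕜] {d : ℕ} (Ω : Set (EuclideanSpace ℝ (Fin d)))

/-- The space of locally integrable functions on `Ω` (values outside `Ω` are irrelevant). -/
def L1loc : Submodule 𝕜 (EuclideanSpace ℝ (Fin d) → 𝕜) where
  carrier := {u | LocallyIntegrableOn u Ω volume}
  add_mem' hu hv := LocallyIntegrableOn.add hu hv
  zero_mem' := locallyIntegrableOn_zero
  smul_mem' c _ hu := LocallyIntegrableOn.smul hu c

/-- The locally integrable functions that agree almost everywhere on `Ω` with a constant. -/
def aeConst : Submodule 𝕜 (L1loc 𝕜 Ω) where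
  carrier := {u | ∃ c : 𝕜, ∀ᵐ x ∂volume.restrict Ω, u.1 x = c}
  add_mem' := by
    rintro u v ⟨c, hc⟩ ⟨c', hc'⟩
    refine ⟨c + c', ?_⟩
    filter_upwards [hc, hc'] with x h h'
    simp [h, h']
  zero_mem' := ⟨0, by simp⟩
  smul_mem' := by
    rintro k u ⟨c, hc⟩
    refine ⟨k * c, ?_⟩
    filter_upwards [hc] with x h
    simp [h]

/-- Cosets of locally integrable functions on `Ω` modulo equality almost everywhere up to an
additive constant. -/
def ModConst : Type _ := L1loc 𝕜 Ω ⧸ aeConst 𝕜 Ω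

instance : AddCommGroup (ModConst 𝕜 Ω) := inferInstanceAs (AddCommGroup (L1loc 𝕜 Ω ⧸ aeConst 𝕜 Ω))

instance : Module 𝕜 (ModConst 𝕜 Ω) := inferInstanceAs (Module 𝕜 (L1loc 𝕜 Ω ⧸ aeConst 𝕜 Ω))

variable {𝕜} {Ω}

theorem luxemburg_congr (a : EuclideanSpace ℝ (Fin d) → ℝ)
    (φ : ℝ → EuclideanSpace ℝ (Fin d) → EuclideanSpace ℝ (Fin d) → ℝ)
    (u v : L1loc 𝕜 Ω) (h : u - v ∈ aeConst 𝕜 Ω) :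
    luxemburg Ω a φ u.1 = luxemburg Ω a φ v.1 := by
  obtain ⟨c, hc⟩ := h
  have key : ∀ l : ℝ, energy Ω a φ (fun x => u.1 x / (l : 𝕜))
      = energy Ω a φ (fun x => v.1 x / (l : 𝕜)) := by
    intro l
    unfold energy
    rw [Measure.volume_eq_prod, ← Measure.prod_restrict]
    apply lintegral_congr_ae
    have h1 := (Measure.quasiMeasurePreserving_fst (μ := volume.restrict Ω)
      (ν := volume.restrict Ω)).ae hc
    have h2 := (Measure.quasiMeasurePreserving_snd (μ := volume.restrict Ω)
      (ν := volume.restrict Ω)).ae hc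
    filter_upwards [h1, h2] with z hz1 hz2
    have e1 : u.1 z.1 - v.1 z.1 = c := hz1
    have e2 : u.1 z.2 - v.1 z.2 = c := hz2
    have e : u.1 z.1 - u.1 z.2 = v.1 z.1 - v.1 z.2 := by
      linear_combination e1 - e2
    simp only [← sub_div, e]
  unfold luxemburg
  simp only [key]

/-- The functional `|·|` on cosets: its common value on all the representatives. -/
def luxemburgCoset (a : EuclideanSpace ℝ (Fin d) → ℝ)
    (φ : ℝ → EuclideanSpace ℝ (Fin d) → EuclideanSpace ℝ (Fin d) → ℝ)
    (U : ModConst 𝕜 Ω) : ℝ≥0∞ :=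
  Quotient.liftOn' U (fun u : L1loc 𝕜 Ω => luxemburg Ω a φ u.1)
    (fun u v h => luxemburg_congr a φ u v ((Submodule.quotientRel_def _).1 h))

variable (𝕜) (Ω) in
/-- The set `Λ(Ω)` of cosets on which the functional `|·|` is finite. -/
def lambdaSet (a : EuclideanSpace ℝ (Fin d) → ℝ)
    (φ : ℝ → EuclideanSpace ℝ (Fin d) → EuclideanSpace ℝ (Fin d) → ℝ) : Set (ModConst 𝕜 Ω) :=
  {U | luxemburgCoset a φ U < ∞}

/-- The functional `|·|`, as a real number, on a linear subspace of the space of cosets. -/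
@[reducible]
def luxemburgNorm (a : EuclideanSpace ℝ (Fin d) → ℝ)
    (φ : ℝ → EuclideanSpace ℝ (Fin d) → EuclideanSpace ℝ (Fin d) → ℝ)
    (L : Submodule 𝕜 (ModConst 𝕜 Ω)) : Norm L :=
  ⟨fun U => (luxemburgCoset a φ U.1).toReal⟩

end Quotient

end NonlocalOrlicz

end

/-! For almost every pair `(x, y)` the function `φ(·, x, y)` turns out to be a convex doubling Young
function: (C2) gives midpoint convexity, (C3) gives the local boundedness that upgrades it to
convexity, and the upper growth bound gives doubling (`isYoung_of_growth`). Convexity of `F` makes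
the Luxemburg functional a seminorm. Doubling makes `F(u / l)` continuous in `l`, so the infimum is
attained and the condition `|u| ≤ l` is the same as `F(u / l) ≤ 1` (`luxemburg_le_iff`); nearly
every later argument goes through this equivalence.

Definiteness and completeness rest on a local Poincaré inequality (`exists_local_poincare`): each
point of `Ω` has a ball on which the `L¹` distance of `u` to one constant `m u`, the same for all
balls, is at most a multiple of `|u|`. It starts on one small ball and spreads by steps shorter than
`r`, where `a ≥ c₀`; the linked components let such steps reach all of `Ω`. Hence `|u| = 0` forces
`u` to be constant. A series with summable norms, once normalized by the constants `m`, converges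
almost everywhere and locally in `L¹`, and Fatou's lemma bounds its remainders.

Uniform convexity starts from a pointwise inequality for scalars `v`, `w`
(`map_norm_add_half_add_le`), where the parallelogram law handles pairs of close moduli. Integrated,
it shows that `F((u + v) / 2)` stays below `1` by a fixed amount when `F((u - v) / 2)` is not small;
doubling translates between the modular and the norm. -/

namespace NonlocalOrlicz

open Filter Topology

/-! ### Convexity and Young functions of one real variable -/

/-- A midpoint convex function that is bounded above on segments is convex. -/
theorem convexOn_of_midpoint_of_bddAbove {s : Set ℝ} (hs : Convex ℝ s) {f : ℝ → ℝ}
    (hmid : ∀ x ∈ s, ∀ y ∈ s, f ((x + y) / 2) ≤ (f x + f y) / 2)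
    (hbdd : ∀ x ∈ s, ∀ y ∈ s, ∃ M, ∀ z ∈ segment ℝ x y, f z ≤ M) : ConvexOn ℝ s f := by
  refine ⟨hs, fun x hx y hy a b ha hb hab => ?_⟩
  obtain ⟨B, hB⟩ := hbdd x hx y hy
  set g : ℝ → ℝ := fun θ => f ((1 - θ) * x + θ * y) - ((1 - θ) * f x + θ * f y) with hg
  have hmem : ∀ θ ∈ Icc (0 : ℝ) 1, (1 - θ) * x + θ * y ∈ segment ℝ x y := fun θ hθ =>
    ⟨1 - θ, θ, by linarith [hθ.2], hθ.1, by ring, by simp⟩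
  have hgB : BddAbove (g '' Icc 0 1) := by
    refine ⟨B + |f x| + |f y|, ?_⟩
    rintro _ ⟨θ, hθ, rfl⟩
    have h1 := hB _ (hmem θ hθ)
    have h2 := mul_nonneg (sub_nonneg.2 hθ.2) (neg_le_iff_add_nonneg.1 (neg_abs_le (f x)))
    have h3 := mul_nonneg hθ.1 (neg_le_iff_add_nonneg.1 (neg_abs_le (f y)))
    have h4 := mul_nonneg hθ.1 (abs_nonneg (f x))
    have h5 := mul_nonneg (sub_nonneg.2 hθ.2) (abs_nonneg (f y))
    simp only [hg]
    linarith
  have hmidg : ∀ p ∈ Icc (0 : ℝ) 1, ∀ q ∈ Icc (0 : ℝ) 1, g ((p + q) / 2) ≤ (g p + g q) / 2 := by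
    intro p hp q hq
    have h := hmid _ (hs.segment_subset hx hy (hmem p hp)) _ (hs.segment_subset hx hy (hmem q hq))
    have e : (1 - (p + q) / 2) * x + (p + q) / 2 * y
        = ((1 - p) * x + p * y + ((1 - q) * x + q * y)) / 2 := by ring
    simp only [hg, e]
    linarith
  have hg0 : g 0 = 0 := by simp [hg]
  have hg1 : g 1 = 0 := by simp [hg]
  -- `g` is the excess over the chord and vanishes at both endpoints. Every `θ` is the midpoint of
  -- an endpoint and another point of `[0, 1]`, so the supremum is at most half of itself, hence at
  -- most `0`.
  have hM : sSup (g '' Icc 0 1) ≤ sSup (g '' Icc 0 1) / 2 := by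
    refine csSup_le ⟨_, 0, by simp, rfl⟩ ?_
    rintro _ ⟨θ, hθ, rfl⟩
    have hle : ∀ p ∈ Icc (0 : ℝ) 1, g p ≤ sSup (g '' Icc 0 1) := fun p hp =>
      le_csSup hgB (mem_image_of_mem g hp)
    rcases le_total θ (1 / 2) with h | h
    · have hp : 2 * θ ∈ Icc (0 : ℝ) 1 := ⟨by linarith [hθ.1], by linarith⟩
      have := hmidg 0 (by simp) (2 * θ) hp
      rw [show (0 + 2 * θ) / 2 = θ by ring, hg0] at this
      linarith [hle _ hp]
    · have hp : 2 * θ - 1 ∈ Icc (0 : ℝ) 1 := ⟨by linarith, by linarith [hθ.2]⟩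
      have := hmidg (2 * θ - 1) hp 1 (by simp)
      rw [show (2 * θ - 1 + 1) / 2 = θ by ring, hg1] at this
      linarith [hle _ hp]
  have hb1 : b ∈ Icc (0 : ℝ) 1 := ⟨hb, by linarith⟩
  have hfin := le_csSup hgB (mem_image_of_mem g hb1)
  obtain rfl : a = 1 - b := by linarith
  simp only [hg, smul_eq_mul] at hfin ⊢
  linarith

/-- Convex functions on `[0, ∞)` vanishing at `0` with doubling constant `K` and value at least
`c` at `1`. -/
structure IsYoung (K c : ℝ) (f : ℝ → ℝ) : Prop where
  convex : ConvexOn ℝ (Ici 0) f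
  zero : f 0 = 0
  nonneg : ∀ t, 0 ≤ t → 0 ≤ f t
  doubling : ∀ t, 0 ≤ t → f (2 * t) ≤ K * f t
  lower : c ≤ f 1

/-- Uniform midpoint convexity on the pairs of relative distance at least `ε`. -/
def IsUniformlyConvex (ε δ : ℝ) (f : ℝ → ℝ) : Prop :=
  ∀ s t : ℝ, 0 < s → 0 < t → ε * max s t ≤ |s - t| → f ((s + t) / 2) ≤ (1 - δ) * ((f s + f t) / 2)

namespace IsYoung

variable {K c : ℝ} {f : ℝ → ℝ}

theorem map_mul_le (hf : IsYoung K c f) {θ t : ℝ} (h0 : 0 ≤ θ) (h1 : θ ≤ 1) (ht : 0 ≤ t) :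
    f (θ * t) ≤ θ * f t := by
  have := hf.convex.2 (mem_Ici.2 le_rfl) (mem_Ici.2 ht) (sub_nonneg.2 h1) h0 (by ring)
  simpa [hf.zero] using this

theorem mono (hf : IsYoung K c f) {s t : ℝ} (hs : 0 ≤ s) (hst : s ≤ t) : f s ≤ f t := by
  rcases hs.eq_or_lt with rfl | hs'
  · rw [hf.zero]
    exact hf.nonneg _ hst
  have ht := hs'.trans_le hst
  have h1 : s / t ≤ 1 := (div_le_one ht).2 hst
  have := hf.map_mul_le (div_nonneg hs ht.le) h1 ht.le
  rw [div_mul_cancel₀ _ ht.ne'] at this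
  exact this.trans (mul_le_of_le_one_left (hf.nonneg _ ht.le) h1)

theorem map_combo_le (hf : IsYoung K c f) {θ s t : ℝ} (h0 : 0 ≤ θ) (h1 : θ ≤ 1) (hs : 0 ≤ s)
    (ht : 0 ≤ t) : f (θ * s + (1 - θ) * t) ≤ θ * f s + (1 - θ) * f t :=
  hf.convex.2 (mem_Ici.2 hs) (mem_Ici.2 ht) h0 (sub_nonneg.2 h1) (by ring)

theorem map_half_add_le (hf : IsYoung K c f) {s t : ℝ} (hs : 0 ≤ s) (ht : 0 ≤ t) :
    f ((s + t) / 2) ≤ (f s + f t) / 2 := by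
  have := hf.map_combo_le (θ := 1 / 2) (by norm_num) (by norm_num) hs ht
  rw [show (s + t) / 2 = 1 / 2 * s + (1 - 1 / 2) * t by ring]
  linarith

/-- `(1 + θ) t` lies between `t` and `2 t`, so convexity interpolates the doubling bound. The point
is that the factor tends to `1` as `θ → 0`. -/
theorem map_one_add_mul_le (hf : IsYoung K c f) {θ t : ℝ} (h0 : 0 ≤ θ) (h1 : θ ≤ 1) (ht : 0 ≤ t) :
    f ((1 + θ) * t) ≤ (1 + θ * (K - 1)) * f t := by
  have h := hf.map_combo_le h0 h1 (mul_nonneg zero_le_two ht) ht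
  have h2 := mul_le_mul_of_nonneg_left (hf.doubling t ht) h0
  rw [show (1 + θ) * t = θ * (2 * t) + (1 - θ) * t by ring]
  linarith

theorem map_two_pow_mul_le (hf : IsYoung K c f) (hK : 0 ≤ K) (n : ℕ) {t : ℝ} (ht : 0 ≤ t) :
    f (2 ^ n * t) ≤ K ^ n * f t := by
  induction n with
  | zero => simp
  | succ n ih =>
    rw [pow_succ', mul_assoc, pow_succ', mul_assoc]
    exact (hf.doubling _ (by positivity)).trans (mul_le_mul_of_nonneg_left ih hK)

/-- Convexity and `f 0 = 0` give `f t ≥ c t` for `t ≥ 1`. This is how the modular comes to control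
`L¹` norms. -/
theorem le_one_add (hf : IsYoung K c f) (hc : 0 < c) {t : ℝ} (ht : 0 ≤ t) : t ≤ 1 + c⁻¹ * f t := by
  rcases le_total t 1 with h | h
  · have := mul_nonneg (inv_nonneg.2 hc.le) (hf.nonneg t ht)
    linarith
  · have ht0 : 0 < t := by linarith
    have h2 := hf.map_mul_le (inv_nonneg.2 ht) (inv_le_one_of_one_le₀ h) ht
    rw [inv_mul_cancel₀ ht0.ne'] at h2
    have h3 := hf.lower.trans h2
    rw [inv_mul_eq_div, le_div_iff₀ ht0] at h3
    have : t ≤ c⁻¹ * f t := by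
      rw [inv_mul_eq_div, le_div_iff₀ hc]
      linarith
    linarith

theorem continuousOn (hf : IsYoung K c f) : ContinuousOn f (Ici 0) := by
  refine hf.convex.continuousOn_Ici ?_
  have hlim : Tendsto (fun t : ℝ => t * f 1) (𝓝[≥] 0) (𝓝 0) := by
    have : Tendsto (fun t : ℝ => t * f 1) (𝓝 0) (𝓝 (0 * f 1)) :=
      tendsto_id.mul_const _
    rw [zero_mul] at this
    exact this.mono_left nhdsWithin_le_nhds
  rw [ContinuousWithinAt, hf.zero]
  refine squeeze_zero' ?_ ?_ hlim
  · filter_upwards [self_mem_nhdsWithin] with t ht using hf.nonneg t ht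
  · filter_upwards [self_mem_nhdsWithin, mem_nhdsWithin_of_mem_nhds (Iic_mem_nhds zero_lt_one)]
      with t ht ht1
    simpa using hf.map_mul_le (t := 1) ht ht1 zero_le_one

/-- The case `s = 0` of uniform convexity, which is assumed only for positive arguments: let `s →
0+`. As `ε < 1`, small `s` is relatively far from `t`. -/
theorem map_half_le (hf : IsYoung K c f) {ε δ : ℝ} (hε : ε < 1)
    (huc : IsUniformlyConvex ε δ f) {t : ℝ} (ht : 0 < t) :
    f (t / 2) ≤ (1 - δ) * (f t / 2) := by
  have hlim : Tendsto (fun s => (1 - δ) * ((f s + f t) / 2)) (𝓝[>] 0)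
      (𝓝 ((1 - δ) * ((f 0 + f t) / 2))) := by
    have : Tendsto f (𝓝[>] 0) (𝓝 (f 0)) :=
      (hf.continuousOn 0 (mem_Ici.2 le_rfl)).mono Ioi_subset_Ici_self
    exact ((this.add_const _).div_const _).const_mul _
  rw [hf.zero, zero_add] at hlim
  refine ge_of_tendsto hlim ?_
  have hpos : 0 < (1 - ε) * t := mul_pos (sub_pos.2 hε) ht
  filter_upwards [self_mem_nhdsWithin, mem_nhdsWithin_of_mem_nhds (Iio_mem_nhds hpos),
    mem_nhdsWithin_of_mem_nhds (Iio_mem_nhds ht)] with s hs0 hs1 hs2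
  have hs0' : 0 < s := hs0
  have hs1' : s < (1 - ε) * t := hs1
  have hs2' : s < t := hs2
  refine (hf.mono (by linarith) (by linarith)).trans (huc s t hs0 ht ?_)
  rw [max_eq_right hs2'.le, abs_of_neg (by linarith)]
  linarith

theorem map_half_add_le_of_le_abs_sub (hf : IsYoung K c f) {ε δ : ℝ} (hε : ε < 1)
    (huc : IsUniformlyConvex ε δ f) {s t : ℝ} (hs : 0 ≤ s) (ht : 0 ≤ t)
    (hst : ε * max s t ≤ |s - t|) : f ((s + t) / 2) ≤ (1 - δ) * ((f s + f t) / 2) := by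
  rcases hs.eq_or_lt with rfl | hs'
  · rcases ht.eq_or_lt with rfl | ht'
    · simp [hf.zero]
    · simpa [hf.zero] using hf.map_half_le hε huc ht'
  · rcases ht.eq_or_lt with rfl | ht'
    · simpa [hf.zero] using hf.map_half_le hε huc hs'
    · exact huc s t hs' ht' hst

/-- Pointwise form of uniform convexity, for arguments in `ℝ` or `ℂ`. -/
theorem map_norm_add_half_add_le {𝕜 : Type*} [RCLike 𝕜] (hf : IsYoung K c f) {ε δ : ℝ}
    (hε0 : 0 < ε) (hε : ε < 1) (hδ : δ ∈ Ioo (0 : ℝ) 1) (huc : IsUniformlyConvex (ε / 2) δ f)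
    (v w : 𝕜) :
    f (‖v + w‖ / 2) + min δ (ε ^ 2 / 16) * f (‖v - w‖ / 2)
      ≤ (1 + min δ (ε ^ 2 / 16) * ε) * ((f ‖v‖ + f ‖w‖) / 2) := by
  set η := min δ (ε ^ 2 / 16) with hη
  have hη0 : 0 < η := lt_min hδ.1 (by positivity)
  have hη1 : η < 1 := (min_le_left _ _).trans_lt hδ.2
  have hv := norm_nonneg v
  have hw := norm_nonneg w
  have fv := hf.nonneg _ hv
  have fw := hf.nonneg _ hw
  have havg := hf.map_half_add_le hv hw
  have hadd : f (‖v + w‖ / 2) ≤ f ((‖v‖ + ‖w‖) / 2) :=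
    hf.mono (by positivity) (by linarith [norm_add_le v w])
  have hsub : f (‖v - w‖ / 2) ≤ f ((‖v‖ + ‖w‖) / 2) :=
    hf.mono (by positivity) (by linarith [norm_sub_le v w])
  have hmax0 : 0 ≤ max ‖v‖ ‖w‖ := le_max_of_le_left hv
  -- If `v` and `w` are relatively close, the difference term is itself at most `ε` times the
  -- average. Otherwise the sum term gains a factor `1 - η`, which pays for the difference term.
  rcases le_total ‖v - w‖ (ε * max ‖v‖ ‖w‖) with h | h
  · have h1 : f (‖v - w‖ / 2) ≤ f (ε / 2 * max ‖v‖ ‖w‖) :=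
      hf.mono (by positivity) (by linarith)
    have h2 := h1.trans (hf.map_mul_le (by positivity) (by linarith) hmax0)
    have h3 : f (max ‖v‖ ‖w‖) ≤ f ‖v‖ + f ‖w‖ := by
      rcases max_choice ‖v‖ ‖w‖ with e | e <;> rw [e] <;> linarith
    have h4 : f (‖v - w‖ / 2) ≤ ε * ((f ‖v‖ + f ‖w‖) / 2) :=
      h2.trans (by nlinarith)
    have h5 := mul_le_mul_of_nonneg_left h4 hη0.le
    linarith
  · suffices hs : f (‖v + w‖ / 2) ≤ (1 - η) * ((f ‖v‖ + f ‖w‖) / 2) by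
      have h5 := mul_le_mul_of_nonneg_left (hsub.trans havg) hη0.le
      have h6 : 0 ≤ η * ε * ((f ‖v‖ + f ‖w‖) / 2) := by positivity
      linarith
    -- Either the moduli are far apart and (C2) applies, or they are close and the gain is
    -- geometric: by the parallelogram law `‖v + w‖²` is at most `(1 - 3ε²/16) (‖v‖ + ‖w‖)²`, which
    -- `η ≤ ε²/16` turns into the factor `(1 - η)²`.
    rcases le_total (ε / 2 * max ‖v‖ ‖w‖) |‖v‖ - ‖w‖| with h' | h'
    · refine (hadd.trans (hf.map_half_add_le_of_le_abs_sub (by linarith) huc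
        hv hw h')).trans ?_
      gcongr
      exact min_le_left _ _
    · have hpar := parallelogram_law_with_norm ℝ v w
      have hsum : ‖v‖ + ‖w‖ ≤ 2 * max ‖v‖ ‖w‖ := by
        linarith [le_max_left ‖v‖ ‖w‖, le_max_right ‖v‖ ‖w‖]
      have hD : (‖v‖ - ‖w‖) ^ 2 ≤ (ε / 2 * max ‖v‖ ‖w‖) ^ 2 := by
        rw [← sq_abs]
        gcongr
      have hE : (ε * max ‖v‖ ‖w‖) ^ 2 ≤ ‖v - w‖ ^ 2 := by gcongr
      have hS : (‖v‖ + ‖w‖) ^ 2 ≤ (2 * max ‖v‖ ‖w‖) ^ 2 := by gcongr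
      have hSε := mul_le_mul_of_nonneg_left hS (sq_nonneg ε)
      have hηle : η ≤ ε ^ 2 / 16 := min_le_right _ _
      have hSη := mul_le_mul_of_nonneg_right hηle (sq_nonneg (‖v‖ + ‖w‖))
      have hη2 := mul_nonneg (sq_nonneg η) (sq_nonneg (‖v‖ + ‖w‖))
      have hS0 := mul_nonneg (sq_nonneg ε) (sq_nonneg (‖v‖ + ‖w‖))
      have hkey : ‖v + w‖ ^ 2 ≤ ((1 - η) * (‖v‖ + ‖w‖)) ^ 2 := by
        nlinarith
      have hle : ‖v + w‖ ≤ (1 - η) * (‖v‖ + ‖w‖) :=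
        le_of_sq_le_sq hkey (mul_nonneg (by linarith) (by positivity))
      calc f (‖v + w‖ / 2) ≤ f ((1 - η) * ((‖v‖ + ‖w‖) / 2)) :=
            hf.mono (by positivity) (by linarith)
        _ ≤ (1 - η) * f ((‖v‖ + ‖w‖) / 2) :=
            hf.map_mul_le (by linarith) (by linarith) (by positivity)
        _ ≤ _ := mul_le_mul_of_nonneg_left havg (by linarith)

end IsYoung

/-- The growth conditions and strict midpoint convexity give a Young function. -/
theorem isYoung_of_growth {f : ℝ → ℝ} {pm pp β c : ℝ} (hpm : 1 < pm) (hβ : 1 ≤ β)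
    (hinc : AlmostIncreasing β (fun t => f t / t ^ pm))
    (hdec : AlmostDecreasing β (fun t => f t / t ^ pp))
    (huc : ∀ n : ℕ, ∃ δ ∈ Ioo (0 : ℝ) 1, IsUniformlyConvex (1 / ((n : ℝ) + 1)) δ f)
    (h0 : f 0 = 0) (hnonneg : ∀ t, 0 ≤ t → 0 ≤ f t) (hc : c ≤ f 1) :
    IsYoung (β * 2 ^ pp) c f := by
  have hbound : ∀ T, 0 ≤ T → ∀ x ∈ Icc 0 T, f x ≤ β * f T := by
    intro T hT x hx
    rcases hx.1.eq_or_lt with rfl | hx0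
    · rw [h0]
      exact mul_nonneg (by linarith) (hnonneg T hT)
    have hT0 := hx0.trans_le hx.2
    have h := hinc x T hx0 hx.2
    simp only at h
    have hxp := Real.rpow_pos_of_pos hx0 pm
    have hTp := Real.rpow_pos_of_pos hT0 pm
    have hle : x ^ pm ≤ T ^ pm := Real.rpow_le_rpow hx0.le hx.2 (by linarith)
    rw [div_le_iff₀ hxp] at h
    refine h.trans ?_
    have hnn : 0 ≤ β * (f T / T ^ pm) :=
      mul_nonneg (by linarith) (div_nonneg (hnonneg T hT) hTp.le)
    refine (mul_le_mul_of_nonneg_left hle hnn).trans_eq ?_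
    field_simp
  -- Distinct points have positive relative distance, which exceeds some `1 / (n + 1)`.
  have hmid : ∀ x ∈ Ioi (0 : ℝ), ∀ y ∈ Ioi (0 : ℝ), f ((x + y) / 2) ≤ (f x + f y) / 2 := by
    intro x hx y hy
    rcases eq_or_ne x y with rfl | hxy
    · simp
    have hx' : 0 < x := hx
    have hy' : 0 < y := hy
    have hpos : 0 < |x - y| / max x y := div_pos (abs_pos.2 (sub_ne_zero.2 hxy)) (by positivity)
    obtain ⟨n, hn⟩ := exists_nat_one_div_lt hpos
    obtain ⟨δ, hδ, h⟩ := huc n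
    refine (h x y hx hy ?_).trans (mul_le_of_le_one_left ?_ (by linarith [hδ.1]))
    · rw [lt_div_iff₀ (by positivity)] at hn
      exact hn.le
    · linarith [hnonneg x hx'.le, hnonneg y hy'.le]
  have hseg : ∀ x ∈ Ici (0 : ℝ), ∀ y ∈ Ici (0 : ℝ), ∃ M, ∀ z ∈ segment ℝ x y, f z ≤ M := by
    intro x hx y hy
    refine ⟨β * f (max x y), fun z hz => hbound _ (le_max_of_le_left hx) _ ?_⟩
    have : segment ℝ x y ⊆ Icc 0 (max x y) :=
      (convex_Icc _ _).segment_subset ⟨hx, le_max_left _ _⟩ ⟨hy, le_max_right _ _⟩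
    exact this hz
  have hconv : ConvexOn ℝ (Ioi 0) f := convexOn_of_midpoint_of_bddAbove (convex_Ioi 0) hmid
    fun x hx y hy => hseg x (Ioi_subset_Ici_self hx) y (Ioi_subset_Ici_self hy)
  have hcont := hconv.continuousOn isOpen_Ioi
  -- Midpoint convexity with an endpoint at `0` is obtained by continuity: `f t ≤ β f(1) t ^ pm`
  -- near `0`, and convexity on the open half-line gives continuity there.
  have hlim0 : Tendsto f (𝓝[>] 0) (𝓝 0) := by
    have hl : Tendsto (fun t : ℝ => β * f 1 * t ^ pm) (𝓝[>] 0) (𝓝 0) := by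
      have : ContinuousAt (fun t : ℝ => β * f 1 * t ^ pm) 0 :=
        (Real.continuousAt_rpow_const _ _ (Or.inr (by linarith))).const_mul _
      have h := this.tendsto
      rw [Real.zero_rpow (by linarith), mul_zero] at h
      exact h.mono_left nhdsWithin_le_nhds
    refine squeeze_zero' ?_ ?_ hl
    · filter_upwards [self_mem_nhdsWithin] with t ht using hnonneg t (le_of_lt ht)
    · filter_upwards [self_mem_nhdsWithin, mem_nhdsWithin_of_mem_nhds (Iic_mem_nhds zero_lt_one)]
        with t ht ht1
      have h := hinc t 1 ht ht1
      simp only [Real.one_rpow, div_one] at h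
      rwa [div_le_iff₀ (Real.rpow_pos_of_pos ht pm)] at h
  have hhalf : ∀ y, 0 < y → f (y / 2) ≤ f y / 2 := by
    intro y hy
    have h1 : Tendsto (fun s => f ((s + y) / 2)) (𝓝[>] 0) (𝓝 (f (y / 2))) := by
      have hy2 : ContinuousAt f (y / 2) := hcont.continuousAt (Ioi_mem_nhds (by linarith))
      have : Tendsto (fun s : ℝ => (s + y) / 2) (𝓝[>] 0) (𝓝 (y / 2)) := by
        have : ContinuousAt (fun s : ℝ => (s + y) / 2) 0 := by fun_prop
        have h := this.tendsto
        rw [zero_add] at h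
        exact h.mono_left nhdsWithin_le_nhds
      exact hy2.tendsto.comp this
    have h2 : Tendsto (fun s => (f s + f y) / 2) (𝓝[>] 0) (𝓝 ((0 + f y) / 2)) :=
      (hlim0.add_const _).div_const _
    rw [zero_add] at h2
    refine le_of_tendsto_of_tendsto h1 h2 ?_
    filter_upwards [self_mem_nhdsWithin] with s hs using hmid s hs y hy
  refine ⟨convexOn_of_midpoint_of_bddAbove (convex_Ici 0) ?_ hseg, h0, hnonneg, ?_, hc⟩
  · intro x hx y hy
    rcases (mem_Ici.1 hx).eq_or_lt with rfl | hx'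
    · rcases (mem_Ici.1 hy).eq_or_lt with rfl | hy'
      · simp
      · simpa [h0] using hhalf y hy'
    · rcases (mem_Ici.1 hy).eq_or_lt with rfl | hy'
      · simpa [h0] using hhalf x hx'
      · exact hmid x hx' y hy'
  · intro t ht
    rcases ht.eq_or_lt with rfl | ht'
    · simp [h0]
    have h := hdec t (2 * t) ht' (by linarith)
    simp only at h
    have htp := Real.rpow_pos_of_pos ht' pp
    rw [Real.mul_rpow zero_le_two ht, div_le_iff₀ (by positivity)] at h
    refine h.trans_eq ?_
    field_simp

/-! ### The energy and the Luxemburg functional -/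

/-- Standing assumptions on the domain, the weight and the integrand: `φ(·, x, y)` is a doubling
Young function for almost all `x, y`. -/
structure Admissible (𝕜 : Type*) [RCLike 𝕜] {d : ℕ} (Ω : Set (EuclideanSpace ℝ (Fin d)))
    (a : EuclideanSpace ℝ (Fin d) → ℝ)
    (φ : ℝ → EuclideanSpace ℝ (Fin d) → EuclideanSpace ℝ (Fin d) → ℝ) (K c : ℝ) : Prop where
  isOpen : IsOpen Ω
  weight_nonneg : ∀ z, 0 ≤ a z
  weight_meas : AEStronglyMeasurable a volume
  meas : MeasurabilityCondition 𝕜 Ω φ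
  young : ∀ᵐ z ∂((volume : Measure (EuclideanSpace ℝ (Fin d) × EuclideanSpace ℝ (Fin d))).restrict
      (Ω ×ˢ Ω)), IsYoung K c (fun t => φ t z.1 z.2)
  one_le : 1 ≤ K
  pos : 0 < c

theorem locallyIntegrableOn_div {𝕜 : Type*} [RCLike 𝕜] {d : ℕ}
    {Ω : Set (EuclideanSpace ℝ (Fin d))} {u : EuclideanSpace ℝ (Fin d) → 𝕜}
    (hu : LocallyIntegrableOn u Ω volume) (k : 𝕜) :
    LocallyIntegrableOn (fun x => u x / k) Ω volume := by
  have := hu.smul k⁻¹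
  simpa only [Pi.smul_def, smul_eq_mul, inv_mul_eq_div] using this

namespace Admissible

variable {𝕜 : Type*} [RCLike 𝕜] {d : ℕ} {Ω : Set (EuclideanSpace ℝ (Fin d))}
  {a : EuclideanSpace ℝ (Fin d) → ℝ}
  {φ : ℝ → EuclideanSpace ℝ (Fin d) → EuclideanSpace ℝ (Fin d) → ℝ} {K c : ℝ}
  {u v w : EuclideanSpace ℝ (Fin d) → 𝕜}

theorem aemeasurable_integrand (h : Admissible 𝕜 Ω a φ K c)
    (hu : LocallyIntegrableOn u Ω volume) :
    AEMeasurable (fun z : EuclideanSpace ℝ (Fin d) × EuclideanSpace ℝ (Fin d) =>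
      ENNReal.ofReal (φ ‖u z.1 - u z.2‖ z.1 z.2 * a (z.1 - z.2)))
      (volume.restrict (Ω ×ˢ Ω)) := by
  have ha : AEMeasurable (fun z : EuclideanSpace ℝ (Fin d) × EuclideanSpace ℝ (Fin d) =>
      a (z.1 - z.2)) (volume.restrict (Ω ×ˢ Ω)) :=
    (h.weight_meas.comp_quasiMeasurePreserving
      (quasiMeasurePreserving_sub volume volume)).aemeasurable.restrict
  exact ((h.meas u hu).mul ha).ennreal_ofReal

theorem energy_le_mul (h : Admissible 𝕜 Ω a φ K c) {p : ℝ} (hp : 0 ≤ p)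
    (hle : ∀ z : EuclideanSpace ℝ (Fin d) × EuclideanSpace ℝ (Fin d),
      IsYoung K c (fun t => φ t z.1 z.2) →
      φ ‖w z.1 - w z.2‖ z.1 z.2 ≤ p * φ ‖u z.1 - u z.2‖ z.1 z.2) :
    energy Ω a φ w ≤ ENNReal.ofReal p * energy Ω a φ u := by
  unfold energy
  rw [← lintegral_const_mul' _ _ ENNReal.ofReal_ne_top]
  refine lintegral_mono_ae ?_
  filter_upwards [h.young] with z hz
  rw [← ENNReal.ofReal_mul hp, ← mul_assoc]
  exact ENNReal.ofReal_le_ofReal (mul_le_mul_of_nonneg_right (hle z hz) (h.weight_nonneg _))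

/-- Integrates a pointwise inequality with two terms on each side. Splitting the integral of a sum
needs measurability of one summand only, so local integrability is asked of `u₁` and `v₁` alone. -/
theorem energy_add_le_add (h : Admissible 𝕜 Ω a φ K c)
    {u₁ u₂ v₁ v₂ : EuclideanSpace ℝ (Fin d) → 𝕜} (hu₁ : LocallyIntegrableOn u₁ Ω volume)
    (hv₁ : LocallyIntegrableOn v₁ Ω volume) {p₁ p₂ q₁ q₂ : ℝ} (hp₁ : 0 ≤ p₁) (hp₂ : 0 ≤ p₂)
    (hq₁ : 0 ≤ q₁) (hq₂ : 0 ≤ q₂)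
    (hle : ∀ᵐ z ∂((volume : Measure (EuclideanSpace ℝ (Fin d) × EuclideanSpace ℝ (Fin d))).restrict
      (Ω ×ˢ Ω)), p₁ * φ ‖u₁ z.1 - u₁ z.2‖ z.1 z.2 + p₂ * φ ‖u₂ z.1 - u₂ z.2‖ z.1 z.2
        ≤ q₁ * φ ‖v₁ z.1 - v₁ z.2‖ z.1 z.2 + q₂ * φ ‖v₂ z.1 - v₂ z.2‖ z.1 z.2) :
    ENNReal.ofReal p₁ * energy Ω a φ u₁ + ENNReal.ofReal p₂ * energy Ω a φ u₂
      ≤ ENNReal.ofReal q₁ * energy Ω a φ v₁ + ENNReal.ofReal q₂ * energy Ω a φ v₂ := by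
  unfold energy
  rw [← lintegral_const_mul' _ _ ENNReal.ofReal_ne_top,
    ← lintegral_const_mul' _ _ ENNReal.ofReal_ne_top,
    ← lintegral_const_mul' _ _ ENNReal.ofReal_ne_top,
    ← lintegral_const_mul' _ _ ENNReal.ofReal_ne_top,
    ← lintegral_add_left' ((h.aemeasurable_integrand hu₁).const_mul _),
    ← lintegral_add_left' ((h.aemeasurable_integrand hv₁).const_mul _)]
  refine lintegral_mono_ae ?_
  filter_upwards [h.young, hle] with z hz hz'
  have ha := h.weight_nonneg (z.1 - z.2)
  have hnn : ∀ k : 𝕜, 0 ≤ φ ‖k‖ z.1 z.2 * a (z.1 - z.2) := fun k =>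
    mul_nonneg (hz.nonneg _ (norm_nonneg k)) ha
  rw [← ENNReal.ofReal_mul hp₁, ← ENNReal.ofReal_mul hp₂, ← ENNReal.ofReal_mul hq₁,
    ← ENNReal.ofReal_mul hq₂, ← ENNReal.ofReal_add (mul_nonneg hp₁ (hnn _))
    (mul_nonneg hp₂ (hnn _)), ← ENNReal.ofReal_add (mul_nonneg hq₁ (hnn _))
    (mul_nonneg hq₂ (hnn _))]
  refine ENNReal.ofReal_le_ofReal ?_
  have := mul_le_mul_of_nonneg_right hz' ha
  linarith

theorem energy_div_antitone (h : Admissible 𝕜 Ω a φ K c) {l m : ℝ} (hl : 0 < l) (hlm : l ≤ m) :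
    energy Ω a φ (fun x => u x / (m : 𝕜)) ≤ energy Ω a φ (fun x => u x / (l : 𝕜)) := by
  have := h.energy_le_mul (u := fun x => u x / (l : 𝕜)) (w := fun x => u x / (m : 𝕜))
    zero_le_one fun z hz => ?_
  · simpa using this
  · rw [one_mul]
    refine hz.mono (norm_nonneg _) ?_
    rw [← sub_div, ← sub_div, norm_div, norm_div, RCLike.norm_ofReal, RCLike.norm_ofReal,
      abs_of_pos hl, abs_of_pos (hl.trans_le hlm)]
    gcongr

theorem energy_div_le_of_le (h : Admissible 𝕜 Ω a φ K c) {l m : ℝ} (hl : 0 < l) (hlm : l ≤ m)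
    (hm : m ≤ 2 * l) :
    energy Ω a φ (fun x => u x / (l : 𝕜))
      ≤ ENNReal.ofReal (1 + (m / l - 1) * (K - 1)) * energy Ω a φ (fun x => u x / (m : 𝕜)) := by
  have h1 : 1 ≤ m / l := (one_le_div hl).2 hlm
  have h2 : m / l ≤ 2 := (div_le_iff₀ hl).2 hm
  have hK := h.one_le
  refine h.energy_le_mul (by nlinarith) fun z hz => ?_
  have := hz.map_one_add_mul_le (θ := m / l - 1) (by linarith) (by linarith)
    (norm_nonneg (u z.1 / (m : 𝕜) - u z.2 / (m : 𝕜)))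
  convert this using 2
  have hm0 := hl.trans_le hlm
  rw [← sub_div, ← sub_div, norm_div, norm_div, RCLike.norm_ofReal, RCLike.norm_ofReal,
    abs_of_pos hl, abs_of_pos hm0]
  field_simp
  ring

/-- The infimum is attained: the energy is at most `1` at every scale `m > l`, and passing from `m`
to `l` costs a factor that tends to `1` as `m ↓ l`. -/
theorem luxemburg_le_iff (h : Admissible 𝕜 Ω a φ K c) {l : ℝ} (hl : 0 < l) :
    luxemburg Ω a φ u ≤ ENNReal.ofReal l ↔ energy Ω a φ (fun x => u x / (l : 𝕜)) ≤ 1 := by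
  refine ⟨fun hle => ?_, fun hle => iInf_le_of_le l (iInf_le_of_le hl (iInf_le_of_le hle le_rfl))⟩
  have hlarge : ∀ m : ℝ, l < m → energy Ω a φ (fun x => u x / (m : 𝕜)) ≤ 1 := by
    intro m hm
    have hlt : luxemburg Ω a φ u < ENNReal.ofReal m :=
      hle.trans_lt ((ENNReal.ofReal_lt_ofReal_iff (hl.trans hm)).2 hm)
    simp only [luxemburg, iInf_lt_iff] at hlt
    obtain ⟨k, hk, hk1, hkm⟩ := hlt
    exact (h.energy_div_antitone hk ((ENNReal.ofReal_lt_ofReal_iff (hl.trans hm)).1 hkm).le).trans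
      hk1
  have hlim : Tendsto (fun m : ℝ => ENNReal.ofReal (1 + (m / l - 1) * (K - 1))) (𝓝[>] l) (𝓝 1) := by
    have hc : ContinuousAt (fun m : ℝ => 1 + (m / l - 1) * (K - 1)) l := by fun_prop
    have ht := hc.tendsto
    rw [div_self hl.ne', sub_self, zero_mul, add_zero] at ht
    have := ENNReal.tendsto_ofReal (ht.mono_left (nhdsWithin_le_nhds (s := Ioi l)))
    rwa [ENNReal.ofReal_one] at this
  refine ge_of_tendsto hlim ?_
  filter_upwards [self_mem_nhdsWithin, mem_nhdsWithin_of_mem_nhds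
    (Iic_mem_nhds (show l < 2 * l by linarith))] with m hm hm2
  refine (h.energy_div_le_of_le hl (le_of_lt hm) hm2).trans ?_
  exact mul_le_of_le_one_right' (hlarge m hm)

/-- `(u + v) / (p + q)` is the convex combination of `u / p` and `v / q` with weight `p / (p + q)`.
The scales must be positive, so both norms are first enlarged by `ε / 2`. -/
theorem luxemburg_add_le (h : Admissible 𝕜 Ω a φ K c) (hu : LocallyIntegrableOn u Ω volume)
    (hv : LocallyIntegrableOn v Ω volume) :
    luxemburg Ω a φ (fun x => u x + v x) ≤ luxemburg Ω a φ u + luxemburg Ω a φ v := by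
  have key : ∀ p q : ℝ, 0 < p → 0 < q → luxemburg Ω a φ u ≤ ENNReal.ofReal p →
      luxemburg Ω a φ v ≤ ENNReal.ofReal q →
      luxemburg Ω a φ (fun x => u x + v x) ≤ ENNReal.ofReal (p + q) := by
    intro p q hp hq hup hvq
    rw [h.luxemburg_le_iff hp] at hup
    rw [h.luxemburg_le_iff hq] at hvq
    rw [h.luxemburg_le_iff (add_pos hp hq)]
    have hθ0 : 0 ≤ p / (p + q) := by positivity
    have hθ1 : p / (p + q) ≤ 1 := (div_le_one (by positivity)).2 (by linarith)
    have := h.energy_add_le_add (u₁ := fun x => (u x + v x) / ((p + q : ℝ) : 𝕜))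
      (u₂ := fun x => (u x + v x) / ((p + q : ℝ) : 𝕜))
      (v₁ := fun x => u x / (p : 𝕜)) (v₂ := fun x => v x / (q : 𝕜))
      (locallyIntegrableOn_div (hu.add hv) _) (locallyIntegrableOn_div hu _)
      zero_le_one le_rfl hθ0 (sub_nonneg.2 hθ1) ?_
    · simp only [ENNReal.ofReal_one, one_mul, ENNReal.ofReal_zero, zero_mul, add_zero] at this
      refine this.trans ((add_le_add (mul_le_of_le_one_right' hup)
        (mul_le_of_le_one_right' hvq)).trans ?_)
      rw [← ENNReal.ofReal_add hθ0 (sub_nonneg.2 hθ1)]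
      simp
    · filter_upwards [h.young] with z hz
      rw [one_mul, zero_mul, add_zero]
      refine le_trans (hz.mono (norm_nonneg _) ?_)
        (hz.map_combo_le hθ0 hθ1 (norm_nonneg _) (norm_nonneg _))
      rw [← sub_div, ← sub_div, ← sub_div, norm_div, norm_div, norm_div, RCLike.norm_ofReal,
        RCLike.norm_ofReal, RCLike.norm_ofReal, abs_of_pos hp, abs_of_pos hq,
        abs_of_pos (add_pos hp hq)]
      have e : p / (p + q) * (‖u z.1 - u z.2‖ / p) + (1 - p / (p + q)) * (‖v z.1 - v z.2‖ / q)
          = (‖u z.1 - u z.2‖ + ‖v z.1 - v z.2‖) / (p + q) := by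
        field_simp
        ring
      rw [e]
      gcongr
      refine le_trans (le_of_eq ?_) (norm_add_le _ _)
      congr 1
      ring
  rcases eq_or_ne (luxemburg Ω a φ u) ∞ with htop | hu'
  · simp [htop]
  rcases eq_or_ne (luxemburg Ω a φ v) ∞ with htop | hv'
  · simp [htop]
  refine ENNReal.le_of_forall_pos_le_add fun ε hε _ => ?_
  have hε' : (0 : ℝ) < ε / 2 := by positivity
  refine (key ((luxemburg Ω a φ u).toReal + ε / 2) ((luxemburg Ω a φ v).toReal + ε / 2)
    (by positivity) (by positivity) ?_ ?_).trans ?_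
  · rw [ENNReal.ofReal_add ENNReal.toReal_nonneg hε'.le, ENNReal.ofReal_toReal hu']
    exact le_self_add
  · rw [ENNReal.ofReal_add ENNReal.toReal_nonneg hε'.le, ENNReal.ofReal_toReal hv']
    exact le_self_add
  · rw [show ∀ x y : ℝ, x + (ε : ℝ) / 2 + (y + ε / 2) = x + y + ε by intros; ring,
      ENNReal.ofReal_add (by positivity) (by positivity), ENNReal.ofReal_add (by positivity)
      (by positivity), ENNReal.ofReal_toReal hu', ENNReal.ofReal_toReal hv',
      ENNReal.ofReal_coe_nnreal]

theorem luxemburg_const (h : Admissible 𝕜 Ω a φ K c) (k : 𝕜) :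
    luxemburg Ω a φ (fun _ => k) = 0 := by
  refine le_antisymm (ENNReal.le_of_forall_pos_le_add fun ε hε _ => ?_) zero_le
  rw [zero_add, ← ENNReal.ofReal_coe_nnreal, h.luxemburg_le_iff (NNReal.coe_pos.2 hε)]
  have : energy Ω a φ (fun _ : EuclideanSpace ℝ (Fin d) => k / ((ε : ℝ) : 𝕜)) = 0 := by
    refine (lintegral_congr_ae ?_).trans lintegral_zero
    filter_upwards [h.young] with z hz
    simp [hz.zero]
  simp [this]

theorem luxemburg_smul (h : Admissible 𝕜 Ω a φ K c) (k : 𝕜) :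
    luxemburg Ω a φ (fun x => k * u x) = ‖k‖ₑ * luxemburg Ω a φ u := by
  have hle : ∀ (k : 𝕜) (u : EuclideanSpace ℝ (Fin d) → 𝕜), k ≠ 0 →
      luxemburg Ω a φ (fun x => k * u x) ≤ ‖k‖ₑ * luxemburg Ω a φ u := by
    intro k u hk
    have hk0 : 0 < ‖k‖ := norm_pos_iff.2 hk
    rcases eq_or_ne (luxemburg Ω a φ u) ∞ with htop | hu'
    · rw [htop, ENNReal.mul_top (by simpa using hk)]
      exact le_top
    refine ENNReal.le_of_forall_pos_le_add fun ε hε _ => ?_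
    have hε' : (0 : ℝ) < ε := NNReal.coe_pos.2 hε
    set l : ℝ := (luxemburg Ω a φ u).toReal + ε / ‖k‖ with hl
    have hl0 : 0 < l := by positivity
    have h1 : luxemburg Ω a φ u ≤ ENNReal.ofReal l := by
      rw [hl, ENNReal.ofReal_add ENNReal.toReal_nonneg (by positivity), ENNReal.ofReal_toReal hu']
      exact le_self_add
    rw [h.luxemburg_le_iff hl0] at h1
    have h2 : luxemburg Ω a φ (fun x => k * u x) ≤ ENNReal.ofReal (‖k‖ * l) := by
      rw [h.luxemburg_le_iff (by positivity)]
      refine le_trans (le_of_eq ?_) h1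
      unfold energy
      refine lintegral_congr fun z => ?_
      have e : ‖k * u z.1 / ((‖k‖ * l : ℝ) : 𝕜) - k * u z.2 / ((‖k‖ * l : ℝ) : 𝕜)‖
          = ‖u z.1 / (l : 𝕜) - u z.2 / (l : 𝕜)‖ := by
        rw [← sub_div, ← sub_div, ← mul_sub, norm_div, norm_div, norm_mul, RCLike.norm_ofReal,
          RCLike.norm_ofReal, abs_of_pos hl0, abs_of_pos (mul_pos hk0 hl0)]
        field_simp
      rw [e]
    refine h2.trans (le_of_eq ?_)
    rw [hl, mul_add, mul_div_cancel₀ _ hk0.ne', ENNReal.ofReal_add (by positivity) hε'.le,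
      ENNReal.ofReal_mul hk0.le, ENNReal.ofReal_toReal hu', ofReal_norm, ENNReal.ofReal_coe_nnreal]
  -- For `k = 0` the identity holds even where the functional is infinite, since `0 * ∞ = 0`.
  rcases eq_or_ne k 0 with rfl | hk
  · simpa using h.luxemburg_const (0 : 𝕜)
  refine le_antisymm (hle k u hk) ?_
  have h1 := hle k⁻¹ (fun x => k * u x) (inv_ne_zero hk)
  simp only [inv_mul_cancel_left₀ hk] at h1
  calc ‖k‖ₑ * luxemburg Ω a φ u
      ≤ ‖k‖ₑ * (‖k⁻¹‖ₑ * luxemburg Ω a φ (fun x => k * u x)) := by gcongr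
    _ = _ := by rw [← mul_assoc, ← enorm_mul, mul_inv_cancel₀ hk, enorm_one, one_mul]

theorem luxemburg_congr_ae (huv : ∃ k : 𝕜, ∀ᵐ x ∂volume.restrict Ω, u x - v x = k)
    (hu : LocallyIntegrableOn u Ω volume) (hv : LocallyIntegrableOn v Ω volume) :
    luxemburg Ω a φ u = luxemburg Ω a φ v :=
  luxemburg_congr a φ ⟨u, hu⟩ ⟨v, hv⟩ huv

/-- Lower semicontinuity of the Luxemburg functional under almost everywhere convergence. -/
theorem luxemburg_le_of_tendsto (h : Admissible 𝕜 Ω a φ K c)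
    {w : ℕ → EuclideanSpace ℝ (Fin d) → 𝕜} (hw : ∀ n, LocallyIntegrableOn (w n) Ω volume)
    (hlim : ∀ᵐ x ∂volume.restrict Ω, Tendsto (fun n => w n x) atTop (𝓝 (u x))) {τ : ℝ≥0∞}
    (hτ : ∀ᶠ n in atTop, luxemburg Ω a φ (w n) ≤ τ) : luxemburg Ω a φ u ≤ τ := by
  rcases eq_or_ne τ ∞ with rfl | hτ'
  · exact le_top
  refine ENNReal.le_of_forall_pos_le_add fun ε hε _ => ?_
  have hε' : (0 : ℝ) < ε := NNReal.coe_pos.2 hε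
  have hl : 0 < τ.toReal + ε := by positivity
  have e : τ + ε = ENNReal.ofReal (τ.toReal + ε) := by
    rw [ENNReal.ofReal_add ENNReal.toReal_nonneg hε'.le, ENNReal.ofReal_toReal hτ',
      ENNReal.ofReal_coe_nnreal]
  rw [e, h.luxemburg_le_iff hl]
  set l := τ.toReal + ε
  have hw1 : ∀ᶠ n in atTop, energy Ω a φ (fun x => w n x / (l : 𝕜)) ≤ 1 := by
    filter_upwards [hτ] with n hn
    rw [← h.luxemburg_le_iff hl, ← e]
    exact hn.trans le_self_add
  have hpt : ∀ᵐ z ∂((volume : Measure (EuclideanSpace ℝ (Fin d) × EuclideanSpace ℝ (Fin d))).restrict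
      (Ω ×ˢ Ω)), Tendsto (fun n => ENNReal.ofReal
        (φ ‖w n z.1 / (l : 𝕜) - w n z.2 / (l : 𝕜)‖ z.1 z.2 * a (z.1 - z.2))) atTop
        (𝓝 (ENNReal.ofReal
          (φ ‖u z.1 / (l : 𝕜) - u z.2 / (l : 𝕜)‖ z.1 z.2 * a (z.1 - z.2)))) := by
    have hy := h.young
    rw [Measure.volume_eq_prod, ← Measure.prod_restrict] at hy ⊢
    filter_upwards [hy, Measure.quasiMeasurePreserving_fst.ae hlim,
      Measure.quasiMeasurePreserving_snd.ae hlim] with z hz h1 h2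
    refine ENNReal.tendsto_ofReal (Tendsto.mul_const _ ?_)
    have h3 := ((h1.div_const (l : 𝕜)).sub (h2.div_const (l : 𝕜))).norm
    have h4 := hz.continuousOn _ (mem_Ici.2 (norm_nonneg (u z.1 / (l : 𝕜) - u z.2 / (l : 𝕜))))
    exact h4.tendsto.comp (tendsto_nhdsWithin_iff.2 ⟨h3, Eventually.of_forall fun n =>
      mem_Ici.2 (norm_nonneg _)⟩)
  -- Fatou's lemma, applied at the scale `l`, which is positive even for `τ = 0`.
  calc energy Ω a φ (fun x => u x / (l : 𝕜))
      = ∫⁻ z in Ω ×ˢ Ω, liminf (fun n => ENNReal.ofReal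
        (φ ‖w n z.1 / (l : 𝕜) - w n z.2 / (l : 𝕜)‖ z.1 z.2 * a (z.1 - z.2))) atTop := by
        refine lintegral_congr_ae ?_
        filter_upwards [hpt] with z hz using hz.liminf_eq.symm
    _ ≤ liminf (fun n => energy Ω a φ (fun x => w n x / (l : 𝕜))) atTop :=
        lintegral_liminf_le' fun n => h.aemeasurable_integrand (locallyIntegrableOn_div (hw n) _)
    _ ≤ 1 := liminf_le_of_frequently_le' hw1.frequently

/-- Uniform convexity of the Luxemburg functional. -/
theorem luxemburg_add_le_two_sub (h : Admissible 𝕜 Ω a φ K c)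
    (huc : ∀ ε : ℝ, 0 < ε → ∃ δ ∈ Ioo (0 : ℝ) 1,
      ∀ᵐ z ∂((volume : Measure (EuclideanSpace ℝ (Fin d) × EuclideanSpace ℝ (Fin d))).restrict
        (Ω ×ˢ Ω)), IsUniformlyConvex ε δ (fun t => φ t z.1 z.2)) {ε : ℝ} (hε : 0 < ε) :
    ∃ δ : ℝ, 0 < δ ∧ δ < 2 ∧ ∀ u v : EuclideanSpace ℝ (Fin d) → 𝕜,
      LocallyIntegrableOn u Ω volume → LocallyIntegrableOn v Ω volume →
      luxemburg Ω a φ u ≤ 1 → luxemburg Ω a φ v ≤ 1 →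
      ENNReal.ofReal ε ≤ luxemburg Ω a φ (fun x => u x - v x) →
      luxemburg Ω a φ (fun x => u x + v x) ≤ ENNReal.ofReal (2 - δ) := by
  have hK := h.one_le
  -- From norm to modular: if `F(w / 2) < K⁻ⁿ`, then doubling `n` times gives `F(2ⁿ w / 2) ≤ 1`, so
  -- `|w| ≤ 2 / 2ⁿ < ε`. Hence `κ = K⁻ⁿ` bounds `F(w / 2)` below once `|w| ≥ ε`.
  obtain ⟨n, hn⟩ : ∃ n : ℕ, 2 / 2 ^ n < ε := by
    obtain ⟨n, hn⟩ := pow_unbounded_of_one_lt (2 / ε) one_lt_two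
    exact ⟨n, by rwa [div_lt_comm₀ (by positivity) hε]⟩
  set κ : ℝ := (K ^ n)⁻¹ with hκ
  have hκ0 : 0 < κ := by positivity
  have hκ1 : κ ≤ 1 := inv_le_one_of_one_le₀ (one_le_pow₀ hK)
  have hsep : ∀ w : EuclideanSpace ℝ (Fin d) → 𝕜, ENNReal.ofReal ε ≤ luxemburg Ω a φ w →
      ENNReal.ofReal κ ≤ energy Ω a φ (fun x => w x / ((2 : ℝ) : 𝕜)) := by
    intro w hw
    by_contra! hlt
    have hl : (0 : ℝ) < 2 / 2 ^ n := by positivity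
    have h1 : luxemburg Ω a φ w ≤ ENNReal.ofReal (2 / 2 ^ n) := by
      rw [h.luxemburg_le_iff hl]
      refine (h.energy_le_mul (u := fun x => w x / ((2 : ℝ) : 𝕜)) (p := K ^ n) (by positivity)
        fun z hz => ?_).trans ?_
      · have := hz.map_two_pow_mul_le (by linarith) n
          (norm_nonneg (w z.1 / ((2 : ℝ) : 𝕜) - w z.2 / ((2 : ℝ) : 𝕜)))
        convert this using 2
        rw [← sub_div, ← sub_div, norm_div, norm_div, RCLike.norm_ofReal, RCLike.norm_ofReal,
          abs_of_pos hl, abs_of_pos two_pos]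
        field_simp
      · refine (mul_le_mul_right hlt.le _).trans ?_
        rw [← ENNReal.ofReal_mul (by positivity), hκ, mul_inv_cancel₀ (by positivity),
          ENNReal.ofReal_one]
    exact absurd (hw.trans h1) (not_le.2 ((ENNReal.ofReal_lt_ofReal_iff hε).2 hn))
  -- The pointwise inequality is used with parameter `κ / 2`, so its error `η κ / 2` is half of the
  -- gain `η κ`; the other half is the net gain `σ`.
  obtain ⟨δ, hδ, hδuc⟩ := huc (κ / 2 / 2) (by positivity)
  set η := min δ ((κ / 2) ^ 2 / 16) with hη
  have hη0 : 0 < η := lt_min hδ.1 (by positivity)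
  have hη1 : η < 1 := (min_le_left _ _).trans_lt hδ.2
  set σ := η * κ / 2 with hσ
  have hσ0 : 0 < σ := by positivity
  have hσ1 : σ ≤ 1 := by
    have : η * κ ≤ 1 * 1 := mul_le_mul hη1.le hκ1 hκ0.le zero_le_one
    linarith
  have hσK : σ / K ≤ 1 := (div_le_one (by linarith)).2 (hσ1.trans hK)
  have hσK0 : 0 < σ / K := div_pos hσ0 (by linarith)
  -- Chosen so that rescaling from `2` down to `l` costs the factor `1 + (σ / K) (K - 1) ≤ 1 + σ`,
  -- and `(1 + σ) (1 - σ) ≤ 1`.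
  set l : ℝ := 2 / (1 + σ / K) with hl
  have hl0 : 0 < l := by positivity
  have hl2 : l < 2 := by
    rw [hl, div_lt_iff₀ (by positivity)]
    linarith
  have hl1 : 1 ≤ l := by
    rw [hl, le_div_iff₀ (by positivity)]
    linarith
  refine ⟨2 - l, by linarith, by linarith, fun u v hu hv hu1 hv1 huv => ?_⟩
  rw [sub_sub_cancel, h.luxemburg_le_iff hl0]
  have henergy : ∀ w : EuclideanSpace ℝ (Fin d) → 𝕜, luxemburg Ω a φ w ≤ 1 →
      energy Ω a φ w ≤ 1 := by
    intro w hw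
    rw [← ENNReal.ofReal_one, h.luxemburg_le_iff one_pos] at hw
    simpa using hw
  have hmain := h.energy_add_le_add (u₁ := fun x => (u x + v x) / ((2 : ℝ) : 𝕜))
    (u₂ := fun x => (u x - v x) / ((2 : ℝ) : 𝕜)) (v₁ := u) (v₂ := v)
    (p₁ := 1) (p₂ := η) (q₁ := (1 + η * (κ / 2)) / 2) (q₂ := (1 + η * (κ / 2)) / 2)
    (locallyIntegrableOn_div (hu.add hv) _) hu zero_le_one hη0.le (by positivity)
    (by positivity) (by
      filter_upwards [h.young, hδuc] with z hz hzuc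
      have := hz.map_norm_add_half_add_le (ε := κ / 2) (by positivity) (by linarith) hδ hzuc
        (u z.1 - u z.2) (v z.1 - v z.2)
      have e1 : ‖(u z.1 + v z.1) / ((2 : ℝ) : 𝕜) - (u z.2 + v z.2) / ((2 : ℝ) : 𝕜)‖
          = ‖u z.1 - u z.2 + (v z.1 - v z.2)‖ / 2 := by
        rw [← sub_div, norm_div, RCLike.norm_ofReal, abs_of_pos two_pos]
        congr 2
        ring
      have e2 : ‖(u z.1 - v z.1) / ((2 : ℝ) : 𝕜) - (u z.2 - v z.2) / ((2 : ℝ) : 𝕜)‖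
          = ‖u z.1 - u z.2 - (v z.1 - v z.2)‖ / 2 := by
        rw [← sub_div, norm_div, RCLike.norm_ofReal, abs_of_pos two_pos]
        congr 2
        ring
      rw [e1, e2]
      linarith)
  have hF : energy Ω a φ (fun x => (u x + v x) / ((2 : ℝ) : 𝕜)) ≤ ENNReal.ofReal (1 - σ) := by
    have h1 : energy Ω a φ (fun x => (u x + v x) / ((2 : ℝ) : 𝕜)) + ENNReal.ofReal (η * κ)
        ≤ ENNReal.ofReal (1 + η * (κ / 2)) := by
      calc _ ≤ ENNReal.ofReal 1 * energy Ω a φ (fun x => (u x + v x) / ((2 : ℝ) : 𝕜))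
            + ENNReal.ofReal η * energy Ω a φ (fun x => (u x - v x) / ((2 : ℝ) : 𝕜)) := by
            rw [ENNReal.ofReal_one, one_mul, ENNReal.ofReal_mul hη0.le]
            gcongr
            exact hsep _ huv
        _ ≤ _ := hmain
        _ ≤ ENNReal.ofReal ((1 + η * (κ / 2)) / 2) + ENNReal.ofReal ((1 + η * (κ / 2)) / 2) :=
            add_le_add (mul_le_of_le_one_right' (henergy u hu1))
              (mul_le_of_le_one_right' (henergy v hv1))
        _ = _ := by
            rw [← ENNReal.ofReal_add (by positivity) (by positivity), add_halves]
    refine (ENNReal.le_sub_of_add_le_right ENNReal.ofReal_ne_top h1).trans ?_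
    rw [← ENNReal.ofReal_sub _ (by positivity)]
    exact ENNReal.ofReal_le_ofReal (by linarith)
  refine (h.energy_div_le_of_le hl0 hl2.le (by linarith)).trans ((mul_le_mul_right hF _).trans ?_)
  have hquot : 2 / l - 1 = σ / K := by
    rw [hl]
    field_simp
    ring
  rw [hquot, ← ENNReal.ofReal_mul (by nlinarith), ENNReal.ofReal_le_one]
  have h2 : σ / K * (K - 1) ≤ σ := by
    rw [div_mul_eq_mul_div, div_le_iff₀ (by linarith)]
    linarith [mul_nonneg hσ0.le (sub_nonneg.2 hK)]
  have h3 := mul_le_mul_of_nonneg_right h2 (sub_nonneg.2 hσ1)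
  linarith [sq_nonneg σ]

end Admissible

/-! ### Chains of short steps and the local Poincaré inequality -/

open Metric

/-- A property that passes from each point of `Ω` to all points of `Ω` at distance less than `r`
holds everywhere in `Ω` as soon as it holds somewhere. -/
theorem ComponentsLinked.forall_of_step {d : ℕ} {Ω : Set (EuclideanSpace ℝ (Fin d))} {r : ℝ}
    (hcomp : ComponentsLinked Ω r) (hr : 0 < r) {P : EuclideanSpace ℝ (Fin d) → Prop}
    (hstep : ∀ x ∈ Ω, ∀ y ∈ Ω, dist x y < r → P x → P y) {x₀ : EuclideanSpace ℝ (Fin d)}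
    (hx₀ : x₀ ∈ Ω) (h₀ : P x₀) : ∀ x ∈ Ω, P x := by
  obtain ⟨C, hC, hlink⟩ := hcomp
  have hcon : ∀ i, IsPreconnected (C i) ∧ C i ⊆ Ω := by
    intro i
    obtain ⟨x, -, hx⟩ : C i ∈ (fun x => connectedComponentIn Ω x) '' Ω := hC ▸ mem_range_self i
    simp only at hx
    rw [← hx]
    exact ⟨isPreconnected_connectedComponentIn, connectedComponentIn_subset Ω x⟩
  -- Inside a component, `P` propagates by connectedness, since it passes both ways between points
  -- closer than `r`.
  have hin : ∀ i, ∀ x ∈ C i, ∀ y ∈ C i, P x → P y := by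
    intro i x hx y hy
    refine (hcon i).1.induction₂' (fun x y => P x → P y) (fun z hz => ?_)
      (fun x y z _ _ _ h1 h2 h => h2 (h1 h)) hx hy
    filter_upwards [self_mem_nhdsWithin, mem_nhdsWithin_of_mem_nhds (ball_mem_nhds z hr)]
      with w hw hzw
    have hzΩ := (hcon i).2 hz
    have hwΩ := (hcon i).2 hw
    exact ⟨hstep z hzΩ w hwΩ (mem_ball'.1 hzw), hstep w hwΩ z hzΩ (mem_ball.1 hzw)⟩
  -- Both directions are needed: the starting component may have any index, so it is linked back to
  -- `C 0` and from there to the target.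
  have hnext : ∀ i, (∃ x ∈ C i, P x) ↔ ∃ x ∈ C (i + 1), P x := by
    intro i
    have h := hlink i
    simp only [iInf_lt_iff] at h
    obtain ⟨x, hx, y, hy, hxy⟩ := h
    rw [edist_dist, ENNReal.ofReal_lt_ofReal_iff hr] at hxy
    have hxΩ := (hcon i).2 hx
    have hyΩ := (hcon (i + 1)).2 hy
    constructor
    · rintro ⟨z, hz, hPz⟩
      exact ⟨y, hy, hstep x hxΩ y hyΩ hxy (hin i z hz x hx hPz)⟩
    · rintro ⟨z, hz, hPz⟩
      exact ⟨x, hx, hstep y hyΩ x hxΩ (by rwa [dist_comm]) (hin (i + 1) z hz y hy hPz)⟩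
  have hall : ∀ i, (∃ x ∈ C 0, P x) ↔ ∃ x ∈ C i, P x := by
    intro i
    induction i with
    | zero => rfl
    | succ i ih => exact ih.trans (hnext i)
  have hmem : ∀ x ∈ Ω, ∃ i, x ∈ C i := by
    intro x hx
    obtain ⟨i, hi⟩ : connectedComponentIn Ω x ∈ range C := hC ▸ mem_image_of_mem _ hx
    exact ⟨i, hi ▸ mem_connectedComponentIn hx⟩
  intro x hx
  obtain ⟨j, hj⟩ := hmem x₀ hx₀
  obtain ⟨i, hi⟩ := hmem x hx
  obtain ⟨y, hy, hPy⟩ := (hall i).1 ((hall j).2 ⟨x₀, hj, h₀⟩)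
  exact hin i y hy x hi hPy

theorem ae_restrict_of_forall_ball {d : ℕ} {Ω : Set (EuclideanSpace ℝ (Fin d))} (hΩ : IsOpen Ω)
    {p : EuclideanSpace ℝ (Fin d) → Prop}
    (h : ∀ x ∈ Ω, ∃ ρ > 0, ∀ᵐ y ∂volume.restrict (ball x ρ), p y) :
    ∀ᵐ y ∂volume.restrict Ω, p y := by
  rw [ae_restrict_iff' hΩ.measurableSet, ae_iff]
  refine measure_null_of_locally_null _ fun x hx => ?_
  simp only [mem_ofPred_eq, Classical.not_imp] at hx
  obtain ⟨ρ, hρ, hb⟩ := h x hx.1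
  rw [ae_restrict_iff' measurableSet_ball, ae_iff] at hb
  refine ⟨_, ?_, hb⟩
  filter_upwards [self_mem_nhdsWithin, mem_nhdsWithin_of_mem_nhds (ball_mem_nhds x hρ)] with y h1 h2
  simp only [Classical.not_imp] at h1 ⊢
  exact ⟨h2, h1.2⟩

namespace Admissible

variable {𝕜 : Type*} [RCLike 𝕜] {d : ℕ} {Ω : Set (EuclideanSpace ℝ (Fin d))}
  {a : EuclideanSpace ℝ (Fin d) → ℝ}
  {φ : ℝ → EuclideanSpace ℝ (Fin d) → EuclideanSpace ℝ (Fin d) → ℝ} {K c : ℝ}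

theorem aemeasurable_enorm_sub {u : EuclideanSpace ℝ (Fin d) → 𝕜}
    (hu : LocallyIntegrableOn u Ω volume) {A B : Set (EuclideanSpace ℝ (Fin d))}
    (hAΩ : A ⊆ Ω) (hBΩ : B ⊆ Ω) :
    AEMeasurable (fun z : EuclideanSpace ℝ (Fin d) × EuclideanSpace ℝ (Fin d) =>
      ‖u z.1 - u z.2‖ₑ) ((volume.restrict A).prod (volume.restrict B)) := by
  have hA : AEStronglyMeasurable u (volume.restrict A) :=
    hu.aestronglyMeasurable.mono_measure (Measure.restrict_mono_set _ hAΩ)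
  have hB : AEStronglyMeasurable u (volume.restrict B) :=
    hu.aestronglyMeasurable.mono_measure (Measure.restrict_mono_set _ hBΩ)
  exact (hA.comp_fst.sub hB.comp_snd).enorm

/-- On `A × B` the weight is at least `c₀`, so `|u(x) - u(y)| / l` is at most `1` plus a constant
times the energy density of `u / l`. Integrating at a scale with `F(u / l) ≤ 1` gives `l (|A| |B| +
c⁻¹ c₀⁻¹)`; then take the infimum over `l`. -/
theorem exists_lintegral_enorm_sub_le (h : Admissible 𝕜 Ω a φ K c) {r c₀ : ℝ} (hc₀ : 0 < c₀)
    (hball : ∀ᵐ z ∂volume.restrict (ball (0 : EuclideanSpace ℝ (Fin d)) r), c₀ ≤ a z)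
    {A B : Set (EuclideanSpace ℝ (Fin d))} (hA : MeasurableSet A) (hB : MeasurableSet B)
    (hAΩ : A ⊆ Ω) (hBΩ : B ⊆ Ω) (hA' : volume A ≠ ∞) (hB' : volume B ≠ ∞)
    (hAB : ∀ x ∈ A, ∀ y ∈ B, dist x y < r) :
    ∃ C : ℝ≥0∞, C ≠ ∞ ∧ ∀ u : EuclideanSpace ℝ (Fin d) → 𝕜, LocallyIntegrableOn u Ω volume →
      ∫⁻ x in A, ∫⁻ y in B, ‖u x - u y‖ₑ ≤ C * luxemburg Ω a φ u := by
  have hcc : 0 < c⁻¹ * c₀⁻¹ := mul_pos (inv_pos.2 h.pos) (inv_pos.2 hc₀)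
  have hC : volume A * volume B + ENNReal.ofReal (c⁻¹ * c₀⁻¹) ≠ ∞ :=
    ENNReal.add_ne_top.2 ⟨ENNReal.mul_ne_top hA' hB', ENNReal.ofReal_ne_top⟩
  have hC0 : volume A * volume B + ENNReal.ofReal (c⁻¹ * c₀⁻¹) ≠ 0 := by
    simp [hcc]
  refine ⟨_, hC, fun u hu => ?_⟩
  rw [mul_comm, ← ENNReal.div_le_iff hC0 hC]
  refine le_iInf fun l => le_iInf fun hl => le_iInf fun hl1 => ?_
  rw [ENNReal.div_le_iff hC0 hC, lintegral_lintegral (aemeasurable_enorm_sub hu hAΩ hBΩ)]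
  have hsubset : A ×ˢ B ⊆ Ω ×ˢ Ω := prod_mono hAΩ hBΩ
  have hae : ∀ᵐ z : EuclideanSpace ℝ (Fin d) × EuclideanSpace ℝ (Fin d)
      ∂((volume.restrict A).prod (volume.restrict B)), ‖u z.1 - u z.2‖ₑ ≤ ENNReal.ofReal l *
        (1 + ENNReal.ofReal (c⁻¹ * c₀⁻¹) * ENNReal.ofReal
          (φ ‖u z.1 / (l : 𝕜) - u z.2 / (l : 𝕜)‖ z.1 z.2 * a (z.1 - z.2))) := by
    rw [Measure.prod_restrict]
    have h1 : ∀ᵐ z ∂(volume : Measure (EuclideanSpace ℝ (Fin d))), z ∈ ball 0 r → c₀ ≤ a z :=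
      (ae_restrict_iff' measurableSet_ball).1 hball
    have h2 := ae_restrict_of_ae (s := A ×ˢ B)
      ((quasiMeasurePreserving_sub (volume : Measure (EuclideanSpace ℝ (Fin d))) volume).ae h1)
    have h3 := ae_restrict_of_ae_restrict_of_subset hsubset h.young
    rw [Measure.volume_eq_prod] at h3
    filter_upwards [h2, h3, ae_restrict_mem (hA.prod hB)] with z hz hy hzAB
    have hz' : c₀ ≤ a (z.1 - z.2) := hz (by
      rw [mem_ball_zero_iff, ← dist_eq_norm]
      exact hAB _ hzAB.1 _ hzAB.2)
    set t := ‖u z.1 / (l : 𝕜) - u z.2 / (l : 𝕜)‖ with ht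
    have ht0 : 0 ≤ t := norm_nonneg _
    have e : ‖u z.1 - u z.2‖ = l * t := by
      rw [ht, ← sub_div, norm_div, RCLike.norm_ofReal, abs_of_pos hl, mul_div_cancel₀ _ hl.ne']
    have hφ := hy.nonneg t ht0
    rw [← ofReal_norm, e, ENNReal.ofReal_mul hl.le, ← ENNReal.ofReal_mul hcc.le,
      ← ENNReal.ofReal_one, ← ENNReal.ofReal_add zero_le_one
      (mul_nonneg hcc.le (mul_nonneg hφ (h.weight_nonneg _)))]
    gcongr
    refine (hy.le_one_add h.pos ht0).trans ?_
    have h4 : φ t z.1 z.2 ≤ c₀⁻¹ * (φ t z.1 z.2 * a (z.1 - z.2)) := by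
      rw [inv_mul_eq_div, le_div_iff₀ hc₀]
      gcongr
    have h5 := mul_le_mul_of_nonneg_left h4 (inv_pos.2 h.pos).le
    linarith
  refine (lintegral_mono_ae hae).trans ?_
  rw [lintegral_const_mul' _ _ ENNReal.ofReal_ne_top, lintegral_add_left measurable_const,
    lintegral_const_mul' _ _ ENNReal.ofReal_ne_top, lintegral_one]
  gcongr
  · rw [Measure.prod_restrict, Measure.restrict_apply_univ, Measure.prod_prod]
  · refine mul_le_of_le_one_right' (le_trans ?_ hl1)
    rw [Measure.prod_restrict, ← Measure.volume_eq_prod]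
    exact lintegral_mono_set hsubset

/-- Local Poincaré inequality: the Luxemburg functional controls locally the distance in `L¹` of a
function to a constant not depending on the location. -/
theorem exists_local_poincare (h : Admissible 𝕜 Ω a φ K c) {r c₀ : ℝ} (hr : 0 < r) (hc₀ : 0 < c₀)
    (hball : ∀ᵐ z ∂volume.restrict (ball (0 : EuclideanSpace ℝ (Fin d)) r), c₀ ≤ a z)
    (hcomp : ComponentsLinked Ω r) :
    ∃ m : (EuclideanSpace ℝ (Fin d) → 𝕜) → 𝕜, ∀ x ∈ Ω, ∃ ρ > 0, ball x ρ ⊆ Ω ∧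
      ∃ C : ℝ≥0∞, C ≠ ∞ ∧ ∀ u : EuclideanSpace ℝ (Fin d) → 𝕜, LocallyIntegrableOn u Ω volume →
        ∫⁻ y in ball x ρ, ‖u y - m u‖ₑ ≤ C * luxemburg Ω a φ u := by
  obtain ⟨x₀, hx₀⟩ : Ω.Nonempty := by
    obtain ⟨C, hC, -⟩ := hcomp
    exact (hC ▸ range_nonempty C : ((fun x => connectedComponentIn Ω x) '' Ω).Nonempty).of_image
  obtain ⟨ρ₁, hρ₁, hsub₁⟩ := isOpen_iff.1 h.isOpen x₀ hx₀
  set ρ₀ := min ρ₁ (r / 2) with hρ₀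
  have hρ₀0 : 0 < ρ₀ := lt_min hρ₁ (half_pos hr)
  have hsub₀ : ball x₀ ρ₀ ⊆ Ω := (ball_subset_ball (min_le_left _ _)).trans hsub₁
  obtain ⟨C₀, hC₀, hle₀⟩ := h.exists_lintegral_enorm_sub_le hc₀ hball
    (measurableSet_ball (x := x₀) (ε := ρ₀)) measurableSet_ball hsub₀ hsub₀ measure_ball_lt_top.ne
    measure_ball_lt_top.ne (fun x hx y hy => by
      have h1 := mem_ball.1 hx
      have h2 := mem_ball'.1 hy
      have h3 := min_le_right ρ₁ (r / 2)
      linarith [dist_triangle x x₀ y])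
  have hvol : ∀ (x : EuclideanSpace ℝ (Fin d)) (ρ : ℝ), 0 < ρ → volume (ball x ρ) ≠ 0 :=
    fun x ρ hρ => (measure_ball_pos volume x hρ).ne'
  -- The constant is a value `u x` at a point where the integral of `|u(x) - u(y)|` over `y` does
  -- not exceed its mean over the ball.
  have hm : ∀ u : EuclideanSpace ℝ (Fin d) → 𝕜, ∃ k : 𝕜, LocallyIntegrableOn u Ω volume →
      ∫⁻ y in ball x₀ ρ₀, ‖u y - k‖ₑ ≤ C₀ / volume (ball x₀ ρ₀) * luxemburg Ω a φ u := by
    intro u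
    by_cases hu : LocallyIntegrableOn u Ω volume
    · obtain ⟨x, -, hx⟩ := exists_le_setLAverage (hvol x₀ ρ₀ hρ₀0) measure_ball_lt_top.ne
        (aemeasurable_enorm_sub hu hsub₀ hsub₀).lintegral_prod_right'
      refine ⟨u x, fun _ => ?_⟩
      simp_rw [enorm_sub_rev _ (u x)]
      refine hx.trans ?_
      rw [setLAverage_eq, ENNReal.mul_comm_div, ← mul_div_assoc]
      gcongr
      exact hle₀ u hu
    · exact ⟨0, fun hu' => absurd hu' hu⟩
  choose m hm using hm
  refine ⟨m, hcomp.forall_of_step hr ?_ hx₀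
    ⟨ρ₀, hρ₀0, hsub₀, _, ENNReal.div_ne_top hC₀ (hvol x₀ ρ₀ hρ₀0), hm⟩⟩
  rintro x hx y hy hxy ⟨ρ, hρ, hρΩ, C, hC, hCle⟩
  obtain ⟨σ₁, hσ₁, hσΩ⟩ := isOpen_iff.1 h.isOpen y hy
  -- Half of the slack, so that points `τ`-close to `x` and to `y` are still within `r` of each
  -- other.
  set τ := (r - dist x y) / 2 with hτ
  have hτ0 : 0 < τ := half_pos (sub_pos.2 hxy)
  set A := ball x (min ρ τ) with hA
  set B := ball y (min σ₁ τ) with hB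
  have hAsub : A ⊆ ball x ρ := ball_subset_ball (min_le_left _ _)
  have hAΩ : A ⊆ Ω := hAsub.trans hρΩ
  have hBΩ : B ⊆ Ω := (ball_subset_ball (min_le_left _ _)).trans hσΩ
  have hA0 : volume A ≠ 0 := hvol _ _ (lt_min hρ hτ0)
  have hB' : volume B ≠ ∞ := measure_ball_lt_top.ne
  obtain ⟨D, hD, hDle⟩ := h.exists_lintegral_enorm_sub_le hc₀ hball (measurableSet_ball :
    MeasurableSet A) (measurableSet_ball : MeasurableSet B) hAΩ hBΩ measure_ball_lt_top.ne hB'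
    (fun x' hx' y' hy' => by
      have h1 := mem_ball.1 hx'
      have h2 := mem_ball'.1 hy'
      have h3 := min_le_right ρ τ
      have h4 := min_le_right σ₁ τ
      linarith [dist_triangle4 x' x y y'])
  refine ⟨min σ₁ τ, lt_min hσ₁ hτ0, hBΩ, (D + volume B * C) / volume A,
    ENNReal.div_ne_top (ENNReal.add_ne_top.2 ⟨hD, ENNReal.mul_ne_top hB' hC⟩) hA0, fun u hu => ?_⟩
  have huA : AEStronglyMeasurable u (volume.restrict A) :=
    hu.aestronglyMeasurable.mono_measure (Measure.restrict_mono_set _ hAΩ)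
  have hmeas1 := (aemeasurable_enorm_sub hu hAΩ hBΩ).lintegral_prod_right'
  have hmeas2 : AEMeasurable (fun x' => volume B * ‖u x' - m u‖ₑ) (volume.restrict A) :=
    (huA.sub aestronglyMeasurable_const).enorm.const_mul _
  -- One intermediate point of `A` at which the sum of both terms, the difference to `B` and the
  -- distance to `m u`, is at most its mean.
  obtain ⟨x', -, hx'⟩ := exists_le_setLAverage hA0 measure_ball_lt_top.ne (hmeas1.add hmeas2)
  calc ∫⁻ y in B, ‖u y - m u‖ₑ ≤ ∫⁻ y in B, (‖u x' - u y‖ₑ + ‖u x' - m u‖ₑ) := by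
        refine lintegral_mono fun y => ?_
        rw [enorm_sub_rev (u x') (u y)]
        refine le_trans (le_of_eq ?_) (enorm_add_le _ _)
        congr 1
        ring
    _ = (∫⁻ y in B, ‖u x' - u y‖ₑ) + volume B * ‖u x' - m u‖ₑ := by
        rw [lintegral_add_right _ measurable_const, setLIntegral_const, mul_comm]
    _ ≤ _ := hx'
    _ ≤ (D * luxemburg Ω a φ u + volume B * (C * luxemburg Ω a φ u)) / volume A := by
        rw [setLAverage_eq]
        simp only [Pi.add_apply]
        rw [lintegral_add_left' hmeas1, lintegral_const_mul' _ _ hB']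
        gcongr
        · exact hDle u hu
        · exact (lintegral_mono_set hAsub).trans (hCle u hu)
    _ = _ := by
        simp only [div_eq_mul_inv]
        ring

end Admissible

/-! ### Definiteness and convergence of series -/

namespace Admissible

variable {𝕜 : Type*} [RCLike 𝕜] {d : ℕ} {Ω : Set (EuclideanSpace ℝ (Fin d))}
  {a : EuclideanSpace ℝ (Fin d) → ℝ}
  {φ : ℝ → EuclideanSpace ℝ (Fin d) → EuclideanSpace ℝ (Fin d) → ℝ} {K c : ℝ}

theorem ae_eq_const_of_luxemburg_eq_zero (h : Admissible 𝕜 Ω a φ K c) {r c₀ : ℝ} (hr : 0 < r)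
    (hc₀ : 0 < c₀)
    (hball : ∀ᵐ z ∂volume.restrict (ball (0 : EuclideanSpace ℝ (Fin d)) r), c₀ ≤ a z)
    (hcomp : ComponentsLinked Ω r) {u : EuclideanSpace ℝ (Fin d) → 𝕜}
    (hu : LocallyIntegrableOn u Ω volume) (h0 : luxemburg Ω a φ u = 0) :
    ∃ k : 𝕜, ∀ᵐ x ∂volume.restrict Ω, u x = k := by
  obtain ⟨m, hm⟩ := h.exists_local_poincare hr hc₀ hball hcomp
  refine ⟨m u, ae_restrict_of_forall_ball h.isOpen fun x hx => ?_⟩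
  obtain ⟨ρ, hρ, hρΩ, C, -, hC⟩ := hm x hx
  refine ⟨ρ, hρ, ?_⟩
  have hle := hC u hu
  rw [h0, mul_zero] at hle
  have hmeas : AEStronglyMeasurable u (volume.restrict (ball x ρ)) :=
    hu.aestronglyMeasurable.mono_measure (Measure.restrict_mono_set _ hρΩ)
  have := (lintegral_eq_zero_iff' (hmeas.sub aestronglyMeasurable_const).enorm).1
    (le_antisymm hle zero_le)
  filter_upwards [this] with y hy
  simpa [sub_eq_zero] using hy

theorem luxemburg_sum_le (h : Admissible 𝕜 Ω a φ K c) {v : ℕ → EuclideanSpace ℝ (Fin d) → 𝕜}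
    (hv : ∀ k, LocallyIntegrableOn (v k) Ω volume) (n : ℕ) :
    LocallyIntegrableOn (fun x => ∑ k ∈ Finset.range n, v k x) Ω volume ∧
    luxemburg Ω a φ (fun x => ∑ k ∈ Finset.range n, v k x)
      ≤ ∑ k ∈ Finset.range n, luxemburg Ω a φ (v k) := by
  induction n with
  | zero => exact ⟨by simpa using locallyIntegrableOn_zero, by simp [h.luxemburg_const (0 : 𝕜)]⟩
  | succ n ih =>
    simp only [Finset.sum_range_succ]
    exact ⟨ih.1.add (hv n), (h.luxemburg_add_le ih.1 (hv n)).trans (by gcongr; exact ih.2)⟩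

/-- An absolutely convergent series converges with respect to the Luxemburg functional. -/
theorem exists_luxemburg_sub_sum_le (h : Admissible 𝕜 Ω a φ K c) {r c₀ : ℝ} (hr : 0 < r)
    (hc₀ : 0 < c₀)
    (hball : ∀ᵐ z ∂volume.restrict (ball (0 : EuclideanSpace ℝ (Fin d)) r), c₀ ≤ a z)
    (hcomp : ComponentsLinked Ω r) {v : ℕ → EuclideanSpace ℝ (Fin d) → 𝕜}
    (hv : ∀ k, LocallyIntegrableOn (v k) Ω volume) (hsum : ∑' k, luxemburg Ω a φ (v k) ≠ ∞) :
    ∃ u : EuclideanSpace ℝ (Fin d) → 𝕜, LocallyIntegrableOn u Ω volume ∧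
      ∀ n, luxemburg Ω a φ (fun x => u x - ∑ k ∈ Finset.range n, v k x)
        ≤ ∑' k, luxemburg Ω a φ (v (k + n)) := by
  obtain ⟨m, hm⟩ := h.exists_local_poincare hr hc₀ hball hcomp
  -- Subtracting the Poincaré constants leaves the functional unchanged and makes the series
  -- absolutely convergent in `L¹` of small balls.
  set w : ℕ → EuclideanSpace ℝ (Fin d) → 𝕜 := fun k x => v k x - m (v k) with hw
  have hwint : ∀ k, LocallyIntegrableOn (w k) Ω volume := fun k =>
    (hv k).sub (locallyIntegrableOn_const _)
  have hwlux : ∀ k, luxemburg Ω a φ (w k) = luxemburg Ω a φ (v k) := fun k =>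
    luxemburg_congr_ae ⟨-m (v k), Eventually.of_forall fun x => by simp [hw]⟩ (hwint k) (hv k)
  have hfin : ∀ x ∈ Ω, ∃ ρ > 0, ball x ρ ⊆ Ω ∧
      ∫⁻ y in ball x ρ, ∑' k, ‖w k y‖ₑ < ∞ := by
    intro x hx
    obtain ⟨ρ, hρ, hρΩ, C, hC, hle⟩ := hm x hx
    refine ⟨ρ, hρ, hρΩ, ?_⟩
    rw [lintegral_tsum fun k => ((hwint k).aestronglyMeasurable.mono_measure
      (Measure.restrict_mono_set _ hρΩ)).enorm]
    refine (ENNReal.tsum_le_tsum fun k => hle (v k) (hv k)).trans_lt ?_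
    rw [ENNReal.tsum_mul_left]
    exact ENNReal.mul_lt_top hC.lt_top hsum.lt_top
  have hmeasball : ∀ x ρ, ball x ρ ⊆ Ω →
      AEMeasurable (fun y => ∑' k, ‖w k y‖ₑ) (volume.restrict (ball x ρ)) := fun x ρ hρΩ =>
    AEMeasurable.tsum fun k => ((hwint k).aestronglyMeasurable.mono_measure
      (Measure.restrict_mono_set _ hρΩ)).enorm
  have hsummable : ∀ᵐ y ∂volume.restrict Ω, Summable fun k => w k y := by
    refine ae_restrict_of_forall_ball h.isOpen fun x hx => ?_
    obtain ⟨ρ, hρ, hρΩ, hlt⟩ := hfin x hx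
    refine ⟨ρ, hρ, ?_⟩
    filter_upwards [ae_lt_top' (hmeasball x ρ hρΩ) hlt.ne] with y hy
    refine Summable.of_norm ?_
    have := ENNReal.summable_toReal hy.ne
    simpa using this
  have htend : ∀ᵐ y ∂volume.restrict Ω,
      Tendsto (fun n => ∑ k ∈ Finset.range n, w k y) atTop (𝓝 (∑' k, w k y)) := by
    filter_upwards [hsummable] with y hy using hy.hasSum.tendsto_sum_nat
  have humeas : AEStronglyMeasurable (fun y => ∑' k, w k y) (volume.restrict Ω) :=
    aestronglyMeasurable_of_tendsto_ae atTop
      (fun n => (h.luxemburg_sum_le hwint n).1.aestronglyMeasurable) htend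
  have hu : LocallyIntegrableOn (fun y => ∑' k, w k y) Ω volume := by
    intro x hx
    obtain ⟨ρ, hρ, hρΩ, hlt⟩ := hfin x hx
    refine ⟨ball x ρ, mem_nhdsWithin_of_mem_nhds (ball_mem_nhds x hρ),
      humeas.mono_measure (Measure.restrict_mono_set _ hρΩ), ?_⟩
    refine lt_of_le_of_lt (lintegral_mono_ae ?_) hlt
    filter_upwards [ae_restrict_of_ae_restrict_of_subset hρΩ htend] with y hy
    refine le_of_tendsto hy.enorm (Eventually.of_forall fun n => ?_)
    exact (enorm_sum_le _ _).trans (ENNReal.sum_le_tsum _)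
  refine ⟨_, hu, fun n => ?_⟩
  have hcongr : luxemburg Ω a φ (fun x => ∑' k, w k x - ∑ k ∈ Finset.range n, v k x)
      = luxemburg Ω a φ (fun x => ∑' k, w k x - ∑ k ∈ Finset.range n, w k x) := by
    refine luxemburg_congr_ae ⟨-∑ k ∈ Finset.range n, m (v k), Eventually.of_forall fun x => ?_⟩
      (hu.sub (h.luxemburg_sum_le hv n).1) (hu.sub (h.luxemburg_sum_le hwint n).1)
    simp only [hw, Finset.sum_sub_distrib]
    ring
  rw [hcongr]
  -- The remainder is the almost everywhere limit of finite tail sums, whose norms the triangle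
  -- inequality bounds.
  refine h.luxemburg_le_of_tendsto (w := fun N x => ∑ k ∈ Finset.range N, w (k + n) x)
    (fun N => (h.luxemburg_sum_le (fun k => hwint (k + n)) N).1) ?_ (Eventually.of_forall fun N => ?_)
  · filter_upwards [hsummable] with y hy
    have h1 := ((summable_nat_add_iff n).2 hy).hasSum.tendsto_sum_nat
    rwa [eq_sub_of_add_eq' (hy.sum_add_tsum_nat_add n)] at h1
  · refine (h.luxemburg_sum_le (fun k => hwint (k + n)) N).2.trans ?_
    simp only [hwlux]
    exact ENNReal.sum_le_tsum _

end Admissible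

/-- The structural conditions on the integrand give an admissible one. -/
theorem admissible_of_conditions {𝕜 : Type*} [RCLike 𝕜] {d : ℕ}
    {Ω : Set (EuclideanSpace ℝ (Fin d))} (hΩ : IsOpen Ω) {a : EuclideanSpace ℝ (Fin d) → ℝ}
    (ha_nonneg : ∀ z, 0 ≤ a z) (ha_meas : AEStronglyMeasurable a volume)
    {φ : ℝ → EuclideanSpace ℝ (Fin d) → EuclideanSpace ℝ (Fin d) → ℝ}
    (hφ_nonneg : ∀ t : ℝ, 0 ≤ t → ∀ x ∈ Ω, ∀ y ∈ Ω, 0 ≤ φ t x y)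
    (hC1 : MeasurabilityCondition 𝕜 Ω φ) (hC2 : UniformConvexityCondition Ω φ)
    {pm pp β : ℝ} (hpm : 1 < pm) (hpp : pm ≤ pp) (hβ : 1 ≤ β) (hC3 : GrowthCondition Ω φ pm pp β)
    {c₁ : ℝ} (hc₁ : 0 < c₁) (hC4 : NormalizationCondition Ω φ c₁) :
    Admissible 𝕜 Ω a φ (β * 2 ^ pp) c₁⁻¹ := by
  refine ⟨hΩ, ha_nonneg, ha_meas, hC1, ?_, ?_, inv_pos.2 hc₁⟩
  -- The exceptional null set in (C2) depends on `ε`; the countable family `1 / (n + 1)` yields a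
  -- single one.
  · have huc : ∀ᵐ z ∂((volume : Measure (EuclideanSpace ℝ (Fin d) ×
        EuclideanSpace ℝ (Fin d))).restrict (Ω ×ˢ Ω)), ∀ n : ℕ, ∃ δ ∈ Ioo (0 : ℝ) 1,
        IsUniformlyConvex (1 / ((n : ℝ) + 1)) δ (fun t => φ t z.1 z.2) := by
      rw [ae_all_iff]
      intro n
      obtain ⟨δ, hδ, h⟩ := hC2 (1 / ((n : ℝ) + 1)) (by positivity)
      filter_upwards [h] with z hz using ⟨δ, hδ, hz⟩
    filter_upwards [huc, hC3, hC4, ae_restrict_mem (hΩ.prod hΩ).measurableSet] with z h2 h3 h4 hz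
    exact isYoung_of_growth hpm hβ h3.1 h3.2 h2 h4.2.2.1
      (fun t ht => hφ_nonneg t ht _ hz.1 _ hz.2) h4.1
  · exact one_le_mul_of_one_le_of_one_le hβ
      (Real.one_le_rpow one_le_two (by linarith))

/-! ### Passage to cosets -/

section Coset

variable {𝕜 : Type*} [RCLike 𝕜] {d : ℕ} {Ω : Set (EuclideanSpace ℝ (Fin d))}

variable (𝕜 Ω) in
/-- The coset of a locally integrable function. -/
def toModConst : L1loc 𝕜 Ω →ₗ[𝕜] ModConst 𝕜 Ω := (aeConst 𝕜 Ω).mkQ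

theorem toModConst_surjective : Function.Surjective (toModConst 𝕜 Ω) :=
  (aeConst 𝕜 Ω).mkQ_surjective

theorem toModConst_eq_zero_iff {u : L1loc 𝕜 Ω} : toModConst 𝕜 Ω u = 0 ↔ u ∈ aeConst 𝕜 Ω :=
  Submodule.Quotient.mk_eq_zero _

variable {a : EuclideanSpace ℝ (Fin d) → ℝ}
  {φ : ℝ → EuclideanSpace ℝ (Fin d) → EuclideanSpace ℝ (Fin d) → ℝ} {K c : ℝ}

theorem luxemburgCoset_toModConst (u : L1loc 𝕜 Ω) :
    luxemburgCoset a φ (toModConst 𝕜 Ω u) = luxemburg Ω a φ u.1 := rfl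

namespace Admissible

theorem luxemburgCoset_add_le (h : Admissible 𝕜 Ω a φ K c) (U V : ModConst 𝕜 Ω) :
    luxemburgCoset a φ (U + V) ≤ luxemburgCoset a φ U + luxemburgCoset a φ V := by
  obtain ⟨u, rfl⟩ := toModConst_surjective U
  obtain ⟨v, rfl⟩ := toModConst_surjective V
  rw [← map_add]
  exact h.luxemburg_add_le u.2 v.2

theorem luxemburgCoset_smul (h : Admissible 𝕜 Ω a φ K c) (k : 𝕜) (U : ModConst 𝕜 Ω) :
    luxemburgCoset a φ (k • U) = ‖k‖ₑ * luxemburgCoset a φ U := by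
  obtain ⟨u, rfl⟩ := toModConst_surjective U
  rw [← map_smul]
  exact h.luxemburg_smul k

theorem luxemburgCoset_zero (h : Admissible 𝕜 Ω a φ K c) :
    luxemburgCoset a φ (0 : ModConst 𝕜 Ω) = 0 := by
  rw [← map_zero (toModConst 𝕜 Ω)]
  exact h.luxemburg_const 0

/-- The space `Λ(Ω)` as a linear subspace of the space of cosets. -/
def lambda (h : Admissible 𝕜 Ω a φ K c) : Submodule 𝕜 (ModConst 𝕜 Ω) where
  carrier := lambdaSet 𝕜 Ω a φ
  add_mem' {U V} hU hV :=
    (h.luxemburgCoset_add_le U V).trans_lt (ENNReal.add_lt_top.2 ⟨hU, hV⟩)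
  zero_mem' := show luxemburgCoset a φ (0 : ModConst 𝕜 Ω) < ∞ by
    rw [h.luxemburgCoset_zero]
    exact ENNReal.zero_lt_top
  smul_mem' k U hU := show luxemburgCoset a φ (k • U) < ∞ by
    rw [h.luxemburgCoset_smul]
    exact ENNReal.mul_lt_top enorm_lt_top hU

theorem normedSpaceCore (h : Admissible 𝕜 Ω a φ K c) {r c₀ : ℝ} (hr : 0 < r) (hc₀ : 0 < c₀)
    (hball : ∀ᵐ z ∂volume.restrict (ball (0 : EuclideanSpace ℝ (Fin d)) r), c₀ ≤ a z)
    (hcomp : ComponentsLinked Ω r) :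
    letI : Norm h.lambda := luxemburgNorm a φ h.lambda
    NormedSpace.Core 𝕜 h.lambda := by
  let : Norm h.lambda := luxemburgNorm a φ h.lambda
  refine
    { norm_nonneg := fun U => ENNReal.toReal_nonneg
      norm_smul := fun k U => ?_
      norm_triangle := fun U V => ?_
      norm_eq_zero_iff := fun U => ⟨fun h0 => ?_, ?_⟩ }
  · change (luxemburgCoset a φ (k • U.1)).toReal = ‖k‖ * (luxemburgCoset a φ U.1).toReal
    rw [h.luxemburgCoset_smul, ENNReal.toReal_mul, toReal_enorm]
  · change (luxemburgCoset a φ (U.1 + V.1)).toReal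
      ≤ (luxemburgCoset a φ U.1).toReal + (luxemburgCoset a φ V.1).toReal
    rw [← ENNReal.toReal_add (ne_of_lt U.2) (ne_of_lt V.2)]
    exact ENNReal.toReal_mono (ENNReal.add_ne_top.2 ⟨ne_of_lt U.2, ne_of_lt V.2⟩)
      (h.luxemburgCoset_add_le _ _)
  · have h1 : luxemburgCoset a φ U.1 = 0 :=
      ((ENNReal.toReal_eq_zero_iff _).1 h0).resolve_right (ne_of_lt U.2)
    obtain ⟨u, hu⟩ := toModConst_surjective U.1
    rw [← hu, luxemburgCoset_toModConst] at h1
    refine Subtype.ext (hu.symm.trans (toModConst_eq_zero_iff.2 ?_))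
    exact h.ae_eq_const_of_luxemburg_eq_zero hr hc₀ hball hcomp u.2 h1
  · rintro rfl
    change (luxemburgCoset a φ (0 : ModConst 𝕜 Ω)).toReal = 0
    rw [h.luxemburgCoset_zero, ENNReal.toReal_zero]

theorem completeSpace_lambda (h : Admissible 𝕜 Ω a φ K c) {r c₀ : ℝ} (hr : 0 < r) (hc₀ : 0 < c₀)
    (hball : ∀ᵐ z ∂volume.restrict (ball (0 : EuclideanSpace ℝ (Fin d)) r), c₀ ≤ a z)
    (hcomp : ComponentsLinked Ω r) :
    letI : Norm h.lambda := luxemburgNorm a φ h.lambda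
    letI : NormedAddCommGroup h.lambda :=
      NormedAddCommGroup.ofCore (h.normedSpaceCore hr hc₀ hball hcomp)
    CompleteSpace h.lambda := by
  let : Norm h.lambda := luxemburgNorm a φ h.lambda
  let : NormedAddCommGroup h.lambda :=
    NormedAddCommGroup.ofCore (h.normedSpaceCore hr hc₀ hball hcomp)
  refine NormedAddCommGroup.completeSpace_of_summable_imp_tendsto fun U hU => ?_
  choose v hv using fun k => toModConst_surjective (U k).1
  have hlux : ∀ k, luxemburg Ω a φ (v k).1 = ENNReal.ofReal ‖U k‖ := by
    intro k
    rw [← luxemburgCoset_toModConst, hv]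
    exact (ENNReal.ofReal_toReal (ne_of_lt (U k).2)).symm
  have hsum : ∑' k, luxemburg Ω a φ (v k).1 ≠ ∞ := by
    simp only [hlux]
    exact hU.tsum_ofReal_ne_top
  obtain ⟨u, hu, hle⟩ :=
    h.exists_luxemburg_sub_sum_le hr hc₀ hball hcomp (fun k => (v k).2) hsum
  have hmem : toModConst 𝕜 Ω ⟨u, hu⟩ ∈ h.lambda := by
    -- The remainder bound at `n = 0` is finiteness of the norm of the sum itself.
    have h0 := hle 0
    simp only [Finset.range_zero, Finset.sum_empty, sub_zero, add_zero] at h0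
    exact h0.trans_lt hsum.lt_top
  refine ⟨⟨_, hmem⟩, ?_⟩
  rw [tendsto_iff_norm_sub_tendsto_zero]
  have hlim : Tendsto (fun n => (∑' k, luxemburg Ω a φ (v (k + n)).1).toReal) atTop (𝓝 0) := by
    have := (ENNReal.tendsto_toReal ENNReal.zero_ne_top).comp
      (ENNReal.tendsto_sum_nat_add (fun k => luxemburg Ω a φ (v k).1) hsum)
    rwa [ENNReal.toReal_zero] at this
  refine squeeze_zero (fun n => norm_nonneg _) (fun n => ?_) hlim
  rw [norm_sub_rev]
  have hne : ∑' k, luxemburg Ω a φ (v (k + n)).1 ≠ ∞ :=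
    ((ENNReal.tsum_comp_le_tsum_of_injective (add_left_injective n) _).trans_lt hsum.lt_top).ne
  have hcoset : ((⟨_, hmem⟩ : h.lambda) - ∑ k ∈ Finset.range n, U k : h.lambda).1
      = toModConst 𝕜 Ω (⟨u, hu⟩ - ∑ k ∈ Finset.range n, v k) := by
    rw [map_sub, map_sum]
    simp only [hv]
    push_cast
    rfl
  have hval : (⟨u, hu⟩ - ∑ k ∈ Finset.range n, v k : L1loc 𝕜 Ω).1
      = fun x => u x - ∑ k ∈ Finset.range n, (v k).1 x := by
    funext x
    simp
  change (luxemburgCoset a φ ((⟨_, hmem⟩ : h.lambda) - ∑ k ∈ Finset.range n, U k : h.lambda).1).toReal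
    ≤ _
  rw [hcoset, luxemburgCoset_toModConst, hval]
  exact ENNReal.toReal_mono hne (hle n)

theorem uniformConvexSpace_lambda (h : Admissible 𝕜 Ω a φ K c) (huc : UniformConvexityCondition Ω φ)
    {r c₀ : ℝ} (hr : 0 < r) (hc₀ : 0 < c₀)
    (hball : ∀ᵐ z ∂volume.restrict (ball (0 : EuclideanSpace ℝ (Fin d)) r), c₀ ≤ a z)
    (hcomp : ComponentsLinked Ω r) :
    letI : Norm h.lambda := luxemburgNorm a φ h.lambda
    letI : NormedAddCommGroup h.lambda :=
      NormedAddCommGroup.ofCore (h.normedSpaceCore hr hc₀ hball hcomp)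
    UniformConvexSpace h.lambda := by
  let : Norm h.lambda := luxemburgNorm a φ h.lambda
  let : NormedAddCommGroup h.lambda :=
    NormedAddCommGroup.ofCore (h.normedSpaceCore hr hc₀ hball hcomp)
  refine ⟨fun ε hε => ?_⟩
  obtain ⟨δ, hδ, hδ2, hmain⟩ := h.luxemburg_add_le_two_sub huc hε
  refine ⟨δ, hδ, fun U hU V hV hUV => ?_⟩
  obtain ⟨u, hu⟩ := toModConst_surjective U.1
  obtain ⟨v, hv⟩ := toModConst_surjective V.1
  have hone : ∀ {W : h.lambda} {w : L1loc 𝕜 Ω}, toModConst 𝕜 Ω w = W.1 → ‖W‖ = 1 →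
      luxemburg Ω a φ w.1 ≤ 1 := by
    intro W w hw hW
    rw [← luxemburgCoset_toModConst, hw]
    exact ((ENNReal.toReal_eq_one_iff _).1 hW).le
  have hsub : ENNReal.ofReal ε ≤ luxemburg Ω a φ (fun x => u.1 x - v.1 x) := by
    have e : toModConst 𝕜 Ω (u - v) = (U - V).1 := by
      rw [map_sub, hu, hv]
      rfl
    change ENNReal.ofReal ε ≤ luxemburgCoset a φ (toModConst 𝕜 Ω (u - v))
    rw [e]
    exact ENNReal.ofReal_le_of_le_toReal hUV
  have hadd := hmain u.1 v.1 u.2 v.2 (hone hu hU) (hone hv hV) hsub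
  have e : toModConst 𝕜 Ω (u + v) = (U + V).1 := by
    rw [map_add, hu, hv]
    rfl
  change luxemburgCoset a φ (toModConst 𝕜 Ω (u + v)) ≤ _ at hadd
  rw [e] at hadd
  -- The bound `δ < 2` enters here: `2 - δ` must be nonnegative to return to real numbers.
  exact ENNReal.toReal_le_of_le_ofReal (by linarith) hadd

end Admissible

end Coset

end NonlocalOrlicz

theorem mainTheorem4 {𝕜 : Type*} [RCLike 𝕜] {d : ℕ} (hd : 1 ≤ d)
    (Ω : Set (EuclideanSpace ℝ (Fin d))) (hΩ : IsOpen Ω)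
    (a : EuclideanSpace ℝ (Fin d) → ℝ) (ha_nonneg : ∀ z, 0 ≤ a z) (ha_int : Integrable a volume)
    (r c₀ : ℝ) (hr : 0 < r) (hc₀ : 0 < c₀)
    (ha_ball : ∀ᵐ z ∂volume.restrict (Metric.ball (0 : EuclideanSpace ℝ (Fin d)) r), c₀ ≤ a z)
    (hcomp : NonlocalOrlicz.ComponentsLinked Ω r)
    (φ : ℝ → EuclideanSpace ℝ (Fin d) → EuclideanSpace ℝ (Fin d) → ℝ)
    (hφ_nonneg : ∀ t : ℝ, 0 ≤ t → ∀ x ∈ Ω, ∀ y ∈ Ω, 0 ≤ φ t x y)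
    (hC1 : NonlocalOrlicz.MeasurabilityCondition 𝕜 Ω φ)
    (hC2 : NonlocalOrlicz.UniformConvexityCondition Ω φ)
    (pm pp β : ℝ) (hpm : 1 < pm) (hpp : pm ≤ pp) (hβ : 1 ≤ β)
    (hC3 : NonlocalOrlicz.GrowthCondition Ω φ pm pp β)
    (c₁ : ℝ) (hc₁ : 0 < c₁)
    (hC4 : NonlocalOrlicz.NormalizationCondition Ω φ c₁) :
    ∃ L : Submodule 𝕜 (NonlocalOrlicz.ModConst 𝕜 Ω),
      (L : Set (NonlocalOrlicz.ModConst 𝕜 Ω)) = NonlocalOrlicz.lambdaSet 𝕜 Ω a φ ∧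
      letI : Norm L := NonlocalOrlicz.luxemburgNorm a φ L
      ∃ core : NormedSpace.Core 𝕜 L,
        letI : NormedAddCommGroup L := NormedAddCommGroup.ofCore core
        CompleteSpace L ∧ UniformConvexSpace L := by
  have h := NonlocalOrlicz.admissible_of_conditions hΩ ha_nonneg ha_int.aestronglyMeasurable
    hφ_nonneg hC1 hC2 hpm hpp hβ hC3 hc₁ hC4
  exact ⟨h.lambda, rfl, h.normedSpaceCore hr hc₀ ha_ball hcomp,
    h.completeSpace_lambda hr hc₀ ha_ball hcomp,
    h.uniformConvexSpace_lambda hC2 hr hc₀ ha_ball hcomp⟩
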